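/- **Setting.** Let $X,Y,Z$ be real locally convex Hausdorff topological vector spaces, let $K\subsetneq Y$ be a closed convex cone with $\operatorname{int}K\neq\emptyset$, and let $S\subset Z$ be a nonempty convex cone. Let $\mathcal L(X,Y)$ denote the continuous linear maps from $X$ to $Y$. Write $Y^\infty=Y\cup\{+\infty_Y\}$ and $Y^\bullet=Y\cup\{\pm\infty_Y\}$. On $Y$ put $a<_K b\iff a-b\in-\operatorname{int}K$ and $a\leqq_K b\iff a-b\in-K$; on $Y^\bullet$, $-\infty_Y<_K y<_K+\infty_Y$ for $y\in Y$ and $-\infty_Y<_K+\infty_Y$; on $Y^\infty$, $+\infty_Y$ is the $\leqq_K$-greatest element. For $M\subset Y^\bullet$, $\operatorname{WSup}M$ is the set of $v\in Y^\bullet$ such that $v\not<_K u$ for all $u\in M$ and every $w<_K v$ satisfies $w<_K u$ for some $u\in M$; $\operatorname{WInf}M$ is the set of $v\in Y^\bullet$ such that $u\not<_K v$ for all $u\in M$ and every $w$ with $v<_K w$ satisfies $u<_K w$ for some $u\in M$; $\operatorname{WMax}M=M\cap\operatorname{WSup}M$. Let $\Phi:X\times Z\to Y^\infty$, $\operatorname{dom}\Phi=\{\Phi\ne+\infty_Y\}$,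 $\operatorname{epi}\Phi=\{(x,z,y)\in X\times Z\times Y:\Phi(x,z)\leqq_K y\}$. $\Phi$ is $K$-convex (resp. $K$-epi closed) if $\operatorname{epi}\Phi$ is convex (resp. closed). Let $\pi(x,z)=z$, $Z_0=\operatorname{lin}\pi(\operatorname{dom}\Phi)$, and assume $0_Z\in\pi(\operatorname{dom}\Phi)$. For $L\in\mathcal L(X,Y)$, $T\in\mathcal L(Z,Y)$ put $$\Phi^*(L,T)=\operatorname{WSup}\{L(x)+T(z)-\Phi(x,z):(x,z)\in X\times Z\},$$ $$\mathcal L_\Phi=\{T\in\mathcal L(Z,Y):\exists L\in\mathcal L(X,Y),\ \Phi^*(L,T)\neq\{+\infty_Y\}\},\qquad \mathcal L_\Phi^+=\{T\in\mathcal L_\Phi: T(S)\subset K\}.$$ *Stable strong duality holds for (P)–(D)* if for every $L\in\mathcal L(X,Y)$ $$\operatorname{WInf}\{\Phi(x,0_Z)-L(x):x\in X\}=\operatorname{WMax}\bigcup_{T\in\mathcal L_\Phi}\bigl(-\Phi^*(L,T)\bigr),$$ and *for (P)–(D$_\ell$)* if the same holds for every $L$ with $\mathcal L_\Phi^+$ in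 place of $\mathcal L_\Phi$. Consider the conditions ($\mathcal N(0_Z)$ is the family of neighbourhoods of $0_Z$): * $(C_0)$ there is $\tilde x$ with $(\tilde x,0_Z)\in\operatorname{dom}\Phi$ and $\Phi(\tilde x,z)\leqq_K\Phi(\tilde x,0_Z)$ for all $z\in-S$; * $(C_2)$ there are $\hat x\in X$, $\hat y\in Y$, $\hat V\in\mathcal N(0_Z)$ with $\Phi(\hat x,z)\leqq_K\hat y$ for all $z\in\hat V\cap Z_0$; * $(C_3)$ there is $\hat x\in X$ such that $\Phi(\hat x,0_Z)\in Y$ and $\Phi(\hat x,\cdot)|_{Z_0}$ is continuous at $0_Z$ (that is, every neighbourhood of $\Phi(\hat x,0_Z)$ in $Y$ contains $\Phi(\hat x,z)$ for all $z\in Z_0$ close to $0_Z$); * $(C_4)$ $\dim Z_0<\infty$ and $0_Z$ lies in the relative interior of $\pi(\operatorname{dom}\Phi)$; * $(C_5)$ $X,Y$ are complete and first countable, $Z_0$ is barrelled, $\Phi$ is $K$-epi closed, and $0_Z$ lies in the intrinsic core of $\pi(\operatorname{dom}\Phi)$ (for every $z\in Z_0$ there is $\delta>0$ with $\lambda z\in\pi(\operatorname{dom}\Phi)$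 for all $\lambda\in[0,\delta]$); * $(C_6)$ $\Phi(x,0_Z)\leqq_K\Phi(x,z)$ for all $(x,z)\in\operatorname{dom}\Phi$, and $\operatorname{int}\pi(\operatorname{dom}\Phi)\ne\emptyset$; * $(C_7)$ $0_Z\in\pi(\operatorname{dom}\Phi)-\operatorname{int}S$, and $\Phi(x,0_Z)\leqq_K\Phi(x,z)$ whenever $(x,z)\in\operatorname{dom}\Phi$ and $z\in S$. **Theorem (Stable strong duality II).** Let $\Phi$ be $K$-convex. (i) If $(C_7)$ holds and $\mathcal L_\Phi\neq\emptyset$, then stable strong duality holds for both (P)–(D) and (P)–(D$_\ell$). (ii) If $(C_5)$ holds, or if $\mathcal L_\Phi\neq\emptyset$ and at least one of $(C_2),(C_3),(C_4),(C_6)$ holds, then stable strong duality holds for (P)–(D); if in addition $(C_0)$ holds, then stable strong duality holds for (P)–(D$_\ell$) as well. -/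

import Mathlib

open Set Filter Topology
open scoped Pointwise

namespace VecDual

/-- `Y ∪ {-∞, +∞}`.  (The set `Y ∪ {+∞}` is `WithTop Y`.) -/
inductive Ext (Y : Type*) where
  | negInf : Ext Y
  | fin : Y → Ext Y
  | posInf : Ext Y

namespace Ext

/-- `-(+∞) = -∞`, `-(-∞) = +∞`. -/
def neg {Y : Type*} [Neg Y] : Ext Y → Ext Y
  | negInf => posInf
  | fin y => fin (-y)
  | posInf => negInf

end Ext

section Order

variable {Y : Type*} [AddCommGroup Y] [Module ℝ Y]

/-- The strict weak ordering `<_K` on `Y ∪ {-∞, +∞}`: on `Y` it is `a - b ∈ -int K`, and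
`-∞ <_K y <_K +∞`, `-∞ <_K +∞`. -/
def ltK [TopologicalSpace Y] (K : ConvexCone ℝ Y) : Ext Y → Ext Y → Prop
  | Ext.fin a, Ext.fin b => a - b ∈ -interior (K : Set Y)
  | Ext.negInf, Ext.fin _ => True
  | Ext.negInf, Ext.posInf => True
  | Ext.fin _, Ext.posInf => True
  | _, _ => False

/-- The ordering `≦_K` on `Y ∪ {+∞}`: on `Y` it is `a - b ∈ -K`, and `+∞` is the greatest
element. -/
def leK (K : ConvexCone ℝ Y) : WithTop Y → WithTop Y → Prop
  | _, none => True
  | none, some _ => False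
  | some a, some b => a - b ∈ -(K : Set Y)

/-- The weak infimum of a subset of `Y ∪ {-∞, +∞}`. -/
def wInf [TopologicalSpace Y] (K : ConvexCone ℝ Y) (M : Set (Ext Y)) : Set (Ext Y) :=
  {v | (∀ u ∈ M, ¬ ltK K u v) ∧ ∀ w, ltK K v w → ∃ u ∈ M, ltK K u w}

/-- The weak supremum of a subset of `Y ∪ {-∞, +∞}`. -/
def wSup [TopologicalSpace Y] (K : ConvexCone ℝ Y) (M : Set (Ext Y)) : Set (Ext Y) :=
  {v | (∀ u ∈ M, ¬ ltK K v u) ∧ ∀ w, ltK K w v → ∃ u ∈ M, ltK K w u}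

/-- The weak maximum. -/
def wMax [TopologicalSpace Y] (K : ConvexCone ℝ Y) (M : Set (Ext Y)) : Set (Ext Y) :=
  M ∩ wSup K M

/-- `v - y`, for `v ∈ Y ∪ {+∞}` and `y ∈ Y`. -/
def topSub : WithTop Y → Y → Ext Y
  | none, _ => Ext.posInf
  | some v, y => Ext.fin (v - y)

/-- `y - v`, for `y ∈ Y` and `v ∈ Y ∪ {+∞}`. -/
def subTop (y : Y) (v : WithTop Y) : Ext Y := (topSub v y).neg

end Order

section Maps

variable {W Y : Type*} [AddCommGroup W] [Module ℝ W] [AddCommGroup Y] [Module ℝ Y]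

/-- The domain of `F : W → Y ∪ {+∞}`. -/
def domF (F : W → WithTop Y) : Set W := {w | F w ≠ ⊤}

/-- The `K`-epigraph of `F`. -/
def epiK (K : ConvexCone ℝ Y) (F : W → WithTop Y) : Set (W × Y) :=
  {p | leK K (F p.1) (p.2 : WithTop Y)}

/-- `K`-convexity of `F`. -/
def KConvex (K : ConvexCone ℝ Y) (F : W → WithTop Y) : Prop := Convex ℝ (epiK K F)

/-- `F` is `K`-epi closed. -/
def KEpiClosed [TopologicalSpace W] [TopologicalSpace Y] (K : ConvexCone ℝ Y)
    (F : W → WithTop Y) : Prop := IsClosed (epiK K F)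

/-- The conjugate mapping `F*(L) = WSup {L w - F w : w ∈ W}`. -/
def conj [TopologicalSpace W] [TopologicalSpace Y] (K : ConvexCone ℝ Y) (F : W → WithTop Y)
    (L : W →L[ℝ] Y) : Set (Ext Y) :=
  wSup K (range fun w => subTop (L w) (F w))

/-- The intrinsic core `icr U`. -/
def icr (U : Set W) : Set W :=
  {x | ∀ x' ∈ affineSpan ℝ U, ∃ δ > (0 : ℝ), ∀ r ∈ Icc (0 : ℝ) δ, x + r • (x' - x) ∈ U}

end Maps

section Algebraic

variable {X Y Z : Type*} [AddCommGroup X] [Module ℝ X] [AddCommGroup Y] [Module ℝ Y]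
  [AddCommGroup Z] [Module ℝ Z]

/-- `π(dom Φ)`, with `π(x, z) = z`. -/
def projDom (Φ : X × Z → WithTop Y) : Set Z := Prod.snd '' domF Φ

/-- `Z₀ = lin (π(dom Φ))`. -/
def Z₀ (Φ : X × Z → WithTop Y) : Submodule ℝ Z := Submodule.span ℝ (projDom Φ)

/-- (C₀): some `(x, 0)` in `dom Φ` satisfies `Φ(x, z) ≦_K Φ(x, 0)` for all `z ∈ -S`. -/
def C0 (K : ConvexCone ℝ Y) (S : ConvexCone ℝ Z) (Φ : X × Z → WithTop Y) : Prop :=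
  ∃ x : X, (x, (0 : Z)) ∈ domF Φ ∧ ∀ z ∈ -(S : Set Z), leK K (Φ (x, z)) (Φ (x, 0))

/-- (C₂): `Φ(x, ·)` is bounded above by a constant on a neighbourhood of `0` in `Z₀`. -/
def C2 [TopologicalSpace Z] (K : ConvexCone ℝ Y) (Φ : X × Z → WithTop Y) : Prop :=
  ∃ (x : X) (y : Y), ∃ V ∈ 𝓝 (0 : Z), ∀ z ∈ V ∩ (Z₀ Φ : Set Z), leK K (Φ (x, z)) (y : WithTop Y)

/-- (C₃): for some `x`, the restriction of `Φ(x, ·)` to `Z₀` is (finite and) continuous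
at `0`. -/
def C3 [TopologicalSpace Y] [TopologicalSpace Z] (Φ : X × Z → WithTop Y) : Prop :=
  ∃ (x : X) (y : Y), Φ (x, 0) = (y : WithTop Y) ∧
    Tendsto (fun z : Z₀ Φ => Φ (x, (z : Z))) (𝓝 0) (map (fun v : Y => (v : WithTop Y)) (𝓝 y))

/-- (C₄): `dim Z₀ < ∞` and `0 ∈ ri (π(dom Φ))`. -/
def C4 [TopologicalSpace Z] (Φ : X × Z → WithTop Y) : Prop :=
  FiniteDimensional ℝ (Z₀ Φ) ∧ (0 : Z) ∈ intrinsicInterior ℝ (projDom Φ)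

/-- (C₅): `X`, `Y` are complete and first countable, `Z₀` is barrelled, `Φ` is `K`-epi closed
and `0 ∈ icr (π(dom Φ))`. -/
def C5 [UniformSpace X] [UniformSpace Y] [TopologicalSpace Z]
    (K : ConvexCone ℝ Y) (Φ : X × Z → WithTop Y) : Prop :=
  (CompleteSpace X ∧ FirstCountableTopology X) ∧ (CompleteSpace Y ∧ FirstCountableTopology Y) ∧
    BarrelledSpace ℝ (Z₀ Φ) ∧ KEpiClosed K Φ ∧ (0 : Z) ∈ icr (projDom Φ)

/-- (C₆): `Φ(x, 0) ≦_K Φ(x, z)` on `dom Φ`, and `int (π(dom Φ)) ≠ ∅`. -/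
def C6 [TopologicalSpace Z] (K : ConvexCone ℝ Y) (Φ : X × Z → WithTop Y) : Prop :=
  (∀ (x : X) (z : Z), (x, z) ∈ domF Φ → leK K (Φ (x, 0)) (Φ (x, z))) ∧
    (interior (projDom Φ)).Nonempty

/-- (C₇): `0 ∈ π(dom Φ) - int S`, and `Φ(x, 0) ≦_K Φ(x, z)` whenever `(x, z) ∈ dom Φ` and
`z ≧_S 0`. -/
def C7 [TopologicalSpace Z] (K : ConvexCone ℝ Y) (S : ConvexCone ℝ Z)
    (Φ : X × Z → WithTop Y) : Prop :=
  (0 : Z) ∈ projDom Φ - interior (S : Set Z) ∧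
    ∀ (x : X) (z : Z), (x, z) ∈ domF Φ → (0 : Z) - z ∈ -(S : Set Z) →
      leK K (Φ (x, 0)) (Φ (x, z))

end Algebraic

section Duality

variable {X Y Z : Type*}
  [AddCommGroup X] [Module ℝ X] [TopologicalSpace X]
  [AddCommGroup Y] [Module ℝ Y] [TopologicalSpace Y] [IsTopologicalAddGroup Y]
  [AddCommGroup Z] [Module ℝ Z] [TopologicalSpace Z]

/-- `Φ*(L, T)`, where `(L, T)` acts on `X × Z` by `(x, z) ↦ L x + T z`. -/
def conjΦ (K : ConvexCone ℝ Y) (Φ : X × Z → WithTop Y) (L : X →L[ℝ] Y) (T : Z →L[ℝ] Y) :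
    Set (Ext Y) :=
  conj K Φ (L.coprod T)

/-- `𝓛_Φ`, the set of all `T` with `(L, T) ∈ dom Φ*` for some `L`. -/
def LΦ (K : ConvexCone ℝ Y) (Φ : X × Z → WithTop Y) : Set (Z →L[ℝ] Y) :=
  {T | ∃ L : X →L[ℝ] Y, conjΦ K Φ L T ≠ {Ext.posInf}}

/-- `𝓛_Φ⁺ = 𝓛_Φ ∩ 𝓛₊(S, K)`. -/
def LΦplus (K : ConvexCone ℝ Y) (S : ConvexCone ℝ Z) (Φ : X × Z → WithTop Y) :
    Set (Z →L[ℝ] Y) :=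
  LΦ K Φ ∩ {T | ∀ s ∈ S, T s ∈ K}

/-- `WInf (P^L)`. -/
def wInfP (K : ConvexCone ℝ Y) (Φ : X × Z → WithTop Y) (L : X →L[ℝ] Y) : Set (Ext Y) :=
  wInf K (range fun x : X => topSub (Φ (x, 0)) (L x))

/-- `WMax (D^L)` for the dual problem whose feasible set of operators is `A`. -/
def wMaxD (K : ConvexCone ℝ Y) (Φ : X × Z → WithTop Y) (A : Set (Z →L[ℝ] Y)) (L : X →L[ℝ] Y) :
    Set (Ext Y) :=
  wMax K (⋃ T ∈ A, Ext.neg '' conjΦ K Φ L T)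

/-- Stable strong duality for (P)-(D). -/
def StableStrongDuality (K : ConvexCone ℝ Y) (Φ : X × Z → WithTop Y) : Prop :=
  ∀ L : X →L[ℝ] Y, wInfP K Φ L = wMaxD K Φ (LΦ K Φ) L

/-- Stable strong duality for (P) and the loose dual problem. -/
def StableStrongDualityLoose (K : ConvexCone ℝ Y) (S : ConvexCone ℝ Z)
    (Φ : X × Z → WithTop Y) : Prop :=
  ∀ L : X →L[ℝ] Y, wInfP K Φ L = wMaxD K Φ (LΦplus K S Φ) L

end Duality

end VecDual

/-!
The vector problem is reduced to scalar convex duality, with operators of rank one. Suppose that `v`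
is a weak lower bound of `x ↦ Φ (x, 0) - L x`. The Hahn-Banach theorem gives a functional `f`,
positive on `int K`, for which `f v` is a lower bound of the scalarized values
(`exists_scalarization`). The scalarized perturbation function is convex, has `0` in the core of its
domain relative to `Z₀`, and is at least `0` at `0` after subtracting `f v`; hence it lies above a
linear form `ℓ` (`exists_linearMap_le_of_core`). Once `ℓ` is continuous it extends to `Z`, and
`T z = ℓ z • k`, with `k ∈ int K` and `f k = 1`, certifies `v` as a weak lower bound of
`(x, z) ↦ Φ (x, z) - L x - T z` (`exists_multiplier`).

The regularity conditions serve to put `0` in that core and to make `ℓ` continuous. Under `C2` and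
`C3` it is bounded above near `0`, under `C4` its domain is finite dimensional, and under `C5` an open
mapping argument (`exists_mem_of_two_smul_mem_closure`, `continuous_of_le_on_closed_convex`) bounds it
near `0`. Under `C6` the operator `T = 0` works outright, and under `C7` the epigraph is first
enlarged by `-S`, which leaves the values at `0` unchanged and gives boundedness near `0`. A rank-one
`T` maps `S` into `K` as soon as `ℓ` is nonnegative on `S`, which is read off by following the
epigraph along `-S`.

Multipliers give strong duality (`wInfP_eq_wMaxD`): finite elements of the weak infimum are attained
in the dual, and a weak lower bound outside the weak infimum can be raised into it
(`exists_add_smul_mem_wInf`). If the primal problem has no finite weak lower bound, both sides are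
`{-∞}` as soon as the dual has a feasible operator; under `C5` one exists because the epigraph is
closed (`LΦ_nonempty_of_KEpiClosed`).
-/

open Set Filter Topology
open scoped Pointwise

namespace VecDual

/-! ### Linear forms below a convex set -/

section Algebraic

variable {W : Type*} [AddCommGroup W] [Module ℝ W]

/-- A convex cone together with its apex; a `ConvexCone` need not contain `0`. -/
def adjoinZero (C : ConvexCone ℝ W) : ConvexCone ℝ W where
  carrier := {w | w = 0 ∨ w ∈ C}
  smul_mem' := by
    rintro c hc w (rfl | hw)
    · exact Or.inl (smul_zero c)
    · exact Or.inr (C.smul_mem hc hw)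
  add_mem' := by
    rintro w (rfl | hw) w' (rfl | hw')
    · exact Or.inl (add_zero 0)
    · rw [zero_add]; exact Or.inr hw'
    · rw [add_zero]; exact Or.inr hw
    · exact Or.inr (C.add_mem hw hw')

/-- An algebraic subgradient at `0`: a convex set in `W × ℝ` that meets the vertical axis only in
nonnegative heights, and whose projection has `0` in its core, lies above the graph of a linear
form. -/
theorem exists_linearMap_le_of_core {C : Set (W × ℝ)} (hC : Convex ℝ C)
    (hnonneg : ∀ r : ℝ, ((0 : W), r) ∈ C → 0 ≤ r)
    (hcore : ∀ w : W, ∃ δ > (0 : ℝ), ∃ r : ℝ, (δ • w, r) ∈ C) :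
    ∃ ℓ : W →ₗ[ℝ] ℝ, ∀ w r, (w, r) ∈ C → ℓ w ≤ r := by
  let s : ConvexCone ℝ (W × ℝ) := adjoinZero (ConvexCone.hull ℝ C)
  have hs : ∀ p, p ∈ s ↔ p = 0 ∨ ∃ t : ℝ, 0 < t ∧ p ∈ t • C := fun p => by
    rw [← ConvexCone.mem_hull_of_convex hC]; exact Iff.rfl
  -- the linear form `(0, r) ↦ r` on the vertical line
  let f : (W × ℝ) →ₗ.[ℝ] ℝ :=
    ⟨LinearMap.range (LinearMap.inr ℝ W ℝ), (LinearMap.snd ℝ W ℝ).domRestrict _⟩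
  obtain ⟨g, hg, hgs⟩ := riesz_extension (s.toPointedCone (Or.inl rfl)) f (by
      rintro ⟨_, r, rfl⟩ hp
      change (0 : ℝ) ≤ r
      rcases (hs _).1 hp with h | ⟨t, ht, ⟨w, q⟩, hq, h⟩
      · exact (congrArg Prod.snd h).ge
      · have h1 : t • w = 0 := congrArg Prod.fst h
        have h2 : t * q = r := congrArg Prod.snd h
        obtain rfl : w = 0 := (smul_eq_zero.1 h1).resolve_left ht.ne'
        rw [← h2]
        exact mul_nonneg ht.le (hnonneg q hq)) (by
      rintro ⟨w, a⟩
      obtain ⟨δ, hδ, r, hr⟩ := hcore w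
      refine ⟨⟨(0, δ⁻¹ * r - a), ⟨_, rfl⟩⟩, (hs _).2 (Or.inr ⟨δ⁻¹, inv_pos.2 hδ, _, hr, ?_⟩)⟩
      ext
      · simp [hδ.ne']
      · simp)
  have hv : ∀ r : ℝ, g (0, r) = r := fun r => hg ⟨(0, r), ⟨r, rfl⟩⟩
  refine ⟨-(g.comp (LinearMap.inl ℝ W ℝ)), fun w r hwr => ?_⟩
  have h := hgs (w, r) ((hs _).2 (Or.inr ⟨1, one_pos, by simpa using hwr⟩))
  have h2 : g (w, r) = g (w, 0) + r := by
    rw [← hv r, ← map_add]; simp [hv]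
  simp only [LinearMap.neg_apply, LinearMap.comp_apply, LinearMap.inl_apply]
  linarith

end Algebraic

/-! ### Continuity of linear forms and barrels -/

section Continuity

variable {W : Type*} [AddCommGroup W] [Module ℝ W] [TopologicalSpace W]
  [IsTopologicalAddGroup W] [ContinuousSMul ℝ W]

theorem continuous_of_eventually_le (ℓ : W →ₗ[ℝ] ℝ) {M : ℝ} (h : ∀ᶠ w in 𝓝 (0 : W), ℓ w ≤ M) :
    Continuous ℓ := by
  have h' : ∀ᶠ w in 𝓝 (0 : W), |ℓ w| ≤ M := by
    have hn : ∀ᶠ w in 𝓝 (0 : W), ℓ (-w) ≤ M :=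
      (continuous_neg.tendsto' (0 : W) 0 neg_zero).eventually h
    filter_upwards [h, hn] with w h1 h2
    rw [map_neg] at h2
    exact abs_le.2 ⟨by linarith, h1⟩
  refine continuous_of_continuousAt_zero ℓ.toAddMonoidHom ?_
  refine Metric.tendsto_nhds.2 fun ε hε => ?_
  have hM : 0 ≤ M := (abs_nonneg _).trans h'.self_of_nhds
  have hc : (0 : ℝ) < (M + 1) / ε := by positivity
  have hsc : Tendsto (fun w : W => ((M + 1) / ε) • w) (𝓝 0) (𝓝 0) :=
    (continuous_const_smul _).tendsto' _ _ (smul_zero _)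
  filter_upwards [hsc.eventually h'] with w hw
  rw [map_smul, smul_eq_mul, abs_mul, abs_of_pos hc] at hw
  change dist (ℓ w) (ℓ 0) < ε
  rw [map_zero, Real.dist_0_eq_abs]
  have : (M + 1) / ε * |ℓ w| < (M + 1) / ε * ε := by
    rw [div_mul_cancel₀ _ hε.ne']; linarith
  exact lt_of_mul_lt_mul_left this hc.le

/-- In a barrelled space a closed convex set with `0` in its core is a neighbourhood of `0`.
It need not be balanced: the gauge of its symmetric part is a lower semicontinuous seminorm. -/
theorem mem_nhds_zero_of_barrel [BarrelledSpace ℝ W] {B : Set W} (hconv : Convex ℝ B)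
    (hclosed : IsClosed B) (h0 : (0 : W) ∈ B) (habs : ∀ w : W, ∃ δ > (0 : ℝ), δ • w ∈ B) :
    B ∈ 𝓝 (0 : W) := by
  set A : Set W := B ∩ -B
  have hAconv : Convex ℝ A := hconv.inter hconv.neg
  have hAclosed : IsClosed A := hclosed.inter hclosed.neg
  have hA0 : (0 : W) ∈ A := ⟨h0, by simpa using h0⟩
  have hAneg : ∀ w ∈ A, -w ∈ A := fun w hw => ⟨hw.2, by simpa using hw.1⟩
  have hAstar : StarConvex ℝ 0 A := hAconv.starConvex hA0
  have hbal : Balanced ℝ A := (balanced_iff_neg_mem hAconv).2 fun {w} hw => hAneg w hw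
  have hshrink : ∀ {w : W} {δ ε : ℝ}, 0 ≤ ε → ε ≤ δ → δ • w ∈ B → ε • w ∈ B := by
    intro w δ ε hε hle hw
    rcases hε.eq_or_lt with rfl | hε'
    · simpa using h0
    · have hδ := hε'.trans_le hle
      have := (hconv.starConvex h0).smul_mem hw (t := ε / δ) (by positivity)
        ((div_le_one hδ).2 hle)
      rwa [smul_smul, div_mul_cancel₀ _ hδ.ne'] at this
  have hAabs : Absorbent ℝ A := by
    refine absorbent_iff_eventually_nhdsNE_zero.2 fun w => ?_
    obtain ⟨δ, hδ, h1⟩ := habs w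
    obtain ⟨ε, hε, h2⟩ := habs (-w)
    have hmin : 0 < min δ ε := lt_min hδ hε
    have hm : min δ ε • w ∈ A := by
      refine ⟨hshrink hmin.le (min_le_left _ _) h1, ?_⟩
      rw [Set.mem_neg, ← smul_neg]
      exact hshrink hmin.le (min_le_right _ _) h2
    have hev : ∀ᶠ c : ℝ in 𝓝 0, ‖c‖ ≤ ‖min δ ε‖ :=
      (continuous_norm.tendsto' (0 : ℝ) 0 norm_zero).eventually_le_const (norm_pos_iff.2 hmin.ne')
    exact hev.filter_mono nhdsWithin_le_nhds |>.mono fun c hc => hbal.smul_mem_mono hm hc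
  have hlsc : LowerSemicontinuous (gaugeSeminorm hbal hAconv hAabs) := by
    refine lowerSemicontinuous_iff_isClosed_preimage.2 fun a => ?_
    change IsClosed {w | gauge A w ≤ a}
    by_cases ha : 0 ≤ a
    · rw [setOfPred_gauge_le_eq hAconv hA0 hAabs ha]
      exact isClosed_iInter fun r => isClosed_iInter fun hr =>
        hAclosed.smul_of_ne_zero (ha.trans_lt hr).ne'
    · convert isClosed_empty
      exact eq_empty_of_forall_notMem fun w hw => ha ((gauge_nonneg w).trans hw)
  have hcont := BarrelledSpace.continuous_of_lowerSemicontinuous _ hlsc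
  have hlt : {w | gaugeSeminorm hbal hAconv hAabs w < 1} ∈ 𝓝 (0 : W) :=
    (isOpen_lt hcont continuous_const).mem_nhds (by simp)
  filter_upwards [hlt] with w hw
  exact (setOfPred_gauge_lt_one_subset_self hAconv hA0 hAabs hw).1

end Continuity
/-! ### The open mapping argument for closed convex processes -/

section OpenMapping

variable {E : Type*} [AddCommGroup E] [UniformSpace E] [IsUniformAddGroup E]

/-- A series whose terms lie in successive members of a halving basis of neighbourhoods of `0`
converges. -/
theorem exists_tendsto_sum_of_mem_basis [CompleteSpace E] [FirstCountableTopology E] {V : ℕ → Set E}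
    (hV : (𝓝 (0 : E)).HasAntitoneBasis V) (hadd : ∀ n, V (n + 1) + V (n + 1) ⊆ V n)
    {e : ℕ → E} (he : ∀ n, e n ∈ V n) :
    ∃ a, Tendsto (fun n => ∑ k ∈ Finset.range n, e k) atTop (𝓝 a) := by
  have h0 : ∀ n, (0 : E) ∈ V n := fun n => mem_of_mem_nhds (hV.mem n)
  have htail : ∀ m n, ∑ k ∈ Finset.range m, e (n + 1 + k) ∈ V n := by
    intro m
    induction m with
    | zero => intro n; simpa using h0 n
    | succ m ih =>
      intro n
      rw [Finset.sum_range_succ']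
      refine hadd n (add_mem_add ?_ (he (n + 1)))
      convert ih (n + 1) using 3
      ring
  have hcauchy : CauchySeq (fun n => ∑ k ∈ Finset.range n, e k) := by
    have hb : (uniformity E).HasBasis (fun _ : ℕ => True)
        fun n => {p : E × E | p.1 - p.2 ∈ V n} := by
      rw [uniformity_eq_comap_nhds_zero_swapped]
      exact hV.1.comap _
    refine hb.cauchySeq_iff'.2 fun n _ => ⟨n + 1, fun m hm => ?_⟩
    obtain ⟨j, rfl⟩ := Nat.exists_eq_add_of_le hm
    simpa [Finset.sum_range_add] using htail j n
  exact cauchySeq_tendsto_of_complete hcauchy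

variable [Module ℝ E] {W : Type*} [AddCommGroup W] [Module ℝ W] [TopologicalSpace W]
  [IsTopologicalAddGroup W] [ContinuousSMul ℝ W]

/-- The iteration behind the open mapping theorem for convex processes.  If every point of
`B n` is a limit of second coordinates of points of the closed convex set `C` with first coordinate
in `u₀ + U n`, then a point `z` with `2 • z ∈ B 0` is the second coordinate of a point of `C`
exactly. -/
theorem exists_mem_of_two_smul_mem_closure [CompleteSpace E] [FirstCountableTopology E]
    {C : Set (E × W)} (hC : Convex ℝ C) (hclosed : IsClosed C) {u₀ : E}
    (hu₀ : (u₀, (0 : W)) ∈ C) {V U : ℕ → Set E} (hV : (𝓝 (0 : E)).HasAntitoneBasis V)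
    (hadd : ∀ n, V (n + 1) + V (n + 1) ⊆ V n) (hUV : ∀ n, U n ⊆ V n)
    (hU0 : ∀ n, U n ∈ 𝓝 (0 : E)) (hUconv : ∀ n, Convex ℝ (U n))
    (hB : ∀ n, closure {w | ∃ d ∈ U n, (u₀ + d, w) ∈ C} ∈ 𝓝 (0 : W))
    {θ : E →L[ℝ] ℝ} (hθ : ∀ n, ∀ d ∈ U n, θ d ≤ 1)
    {z : W} (hz : (2 : ℝ) • z ∈ closure {w | ∃ d ∈ U 0, (u₀ + d, w) ∈ C}) :
    ∃ a, θ a ≤ 1 ∧ (u₀ + a, z) ∈ C := by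
  set B : ℕ → Set W := fun n => closure {w | ∃ d ∈ U n, (u₀ + d, w) ∈ C}
  have hUz : ∀ n, (0 : E) ∈ U n := fun n => mem_of_mem_nhds (hU0 n)
  have hUs : ∀ n (t : ℝ), 0 ≤ t → t ≤ 1 → ∀ d ∈ U n, t • d ∈ U n := fun n t h0 h1 d hd =>
    ((hUconv n).starConvex (hUz n)).smul_mem hd h0 h1
  -- one step: replace the remainder `r` by `2 • r - w`
  have hstep : ∀ n (r : W), (2 : ℝ) • r ∈ B n → ∃ d w, d ∈ U n ∧ (u₀ + d, w) ∈ C ∧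
      (2 : ℝ) • ((2 : ℝ) • r - w) ∈ B (n + 1) := by
    intro n r hr
    have hnb : {w : W | (2 : ℝ) • ((2 : ℝ) • r - w) ∈ B (n + 1)} ∈ 𝓝 ((2 : ℝ) • r) := by
      have hc : Continuous fun w : W => (2 : ℝ) • ((2 : ℝ) • r - w) := by fun_prop
      exact hc.tendsto' _ 0 (by simp) (hB (n + 1))
    obtain ⟨w, hw, d, hd, hdw⟩ := mem_closure_iff_nhds.1 hr _ hnb
    exact ⟨d, w, hd, hdw, hw⟩
  choose! D w hD hDw hnext using hstep
  let r : ℕ → W := fun n => Nat.rec z (fun n x => (2 : ℝ) • x - w n x) n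
  have hr0 : r 0 = z := rfl
  have hrs : ∀ n, r (n + 1) = (2 : ℝ) • r n - w n (r n) := fun n => rfl
  have hrB : ∀ n, (2 : ℝ) • r n ∈ B n := by
    intro n
    induction n with
    | zero => exact hz
    | succ n ih => exact hnext n _ ih
  set e : ℕ → E := fun n => ((2 : ℝ)⁻¹ ^ (n + 1)) • D n (r n) with he
  have heV : ∀ n, e n ∈ V n := fun n =>
    hUV n (hUs n _ (by positivity) (pow_le_one₀ (by norm_num) (by norm_num)) _ (hD n _ (hrB n)))
  obtain ⟨a, ha⟩ := exists_tendsto_sum_of_mem_basis hV hadd heV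
  -- the convex combinations of the points chosen so far with an arbitrary point of `C`
  have hcomb : ∀ n (d : E) (w' : W), (u₀ + d, w') ∈ C →
      (u₀ + (∑ k ∈ Finset.range n, e k + ((2 : ℝ)⁻¹ ^ n) • d),
        z - ((2 : ℝ)⁻¹ ^ n) • (r n - w')) ∈ C := by
    intro n
    induction n with
    | zero => intro d w' h; simpa [hr0] using h
    | succ n ih =>
      intro d w' h
      have hmid := hC (hDw n _ (hrB n)) h (by norm_num : (0 : ℝ) ≤ 2⁻¹)
        (by norm_num : (0 : ℝ) ≤ 2⁻¹) (by norm_num)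
      have := ih ((2 : ℝ)⁻¹ • D n (r n) + (2 : ℝ)⁻¹ • d)
        ((2 : ℝ)⁻¹ • w n (r n) + (2 : ℝ)⁻¹ • w') (by
          convert hmid using 1
          ext
          · simp only [Prod.fst_add, Prod.smul_fst]
            module
          · simp)
      convert this using 1
      ext
      · rw [Finset.sum_range_succ, he]
        simp only [pow_succ]
        module
      · rw [hrs]
        simp only [pow_succ]
        module
  -- `(2⁻¹ ^ n) • r n` need not tend to `0`, as `W` has no countable basis; instead, for each
  -- neighbourhood of `z`, the last point of the combination is chosen close enough to `r n`
  have hlim : (u₀ + a, z) ∈ closure C := by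
    refine mem_closure_iff_nhds.2 fun N hN => ?_
    obtain ⟨N₁, hN₁, N₂, hN₂, hsub⟩ := mem_nhds_prod_iff.1 hN
    have hex : ∀ n, ∃ d w', d ∈ U n ∧ (u₀ + d, w') ∈ C ∧
        z - ((2 : ℝ)⁻¹ ^ n) • (r n - w') ∈ N₂ := by
      intro n
      have hnb : {x : W | z - ((2 : ℝ)⁻¹ ^ n) • (r n - (2 : ℝ)⁻¹ • x) ∈ N₂} ∈
          𝓝 ((2 : ℝ) • r n) := by
        have hc : Continuous fun x : W => z - ((2 : ℝ)⁻¹ ^ n) • (r n - (2 : ℝ)⁻¹ • x) := by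
          fun_prop
        exact hc.tendsto' _ z (by simp [smul_smul]) hN₂
      obtain ⟨x, hx, d, hd, hdx⟩ := mem_closure_iff_nhds.1 (hrB n) _ hnb
      -- averaging with `(u₀, 0)` turns an approximation of `2 • r n` into one of `r n`
      refine ⟨(2 : ℝ)⁻¹ • d, (2 : ℝ)⁻¹ • x, hUs n _ (by norm_num) (by norm_num) d hd, ?_, hx⟩
      convert hC hu₀ hdx (by norm_num : (0 : ℝ) ≤ 2⁻¹) (by norm_num : (0 : ℝ) ≤ 2⁻¹)
        (by norm_num) using 1
      ext
      · simp only [Prod.fst_add, Prod.smul_fst]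
        module
      · simp
    choose d w' hd hdC hdN using hex
    have hsmall : Tendsto (fun n => ((2 : ℝ)⁻¹ ^ n) • d n) atTop (𝓝 0) :=
      hV.tendsto fun n => hUV n (hUs n _ (by positivity)
        (pow_le_one₀ (by norm_num) (by norm_num)) _ (hd n))
    have htend := tendsto_const_nhds (x := u₀) |>.add (ha.add hsmall)
    rw [add_zero] at htend
    obtain ⟨n, hn⟩ := (htend.eventually_mem hN₁).exists
    exact ⟨_, hsub (mk_mem_prod hn (hdN n)), hcomb n _ _ (hdC n)⟩
  refine ⟨a, ?_, hclosed.closure_eq ▸ hlim⟩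
  have hsum : ∀ n, θ (∑ k ∈ Finset.range n, e k) ≤ 1 - (2 : ℝ)⁻¹ ^ n := by
    intro n
    induction n with
    | zero => simp
    | succ n ih =>
      rw [Finset.sum_range_succ, map_add, show θ (e n) = 2⁻¹ ^ (n + 1) * θ (D n (r n)) by simp [he]]
      have h1 := mul_le_mul_of_nonneg_left (hθ n _ (hD n _ (hrB n)))
        (by positivity : (0 : ℝ) ≤ 2⁻¹ ^ (n + 1))
      rw [pow_succ] at *
      linarith
  exact le_of_tendsto ((θ.continuous.tendsto a).comp ha) (Eventually.of_forall fun n =>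
    (hsum n).trans (sub_le_self _ (by positivity)))

/-- A linear form on a barrelled space is continuous once a continuous affine form on a complete
first countable space dominates it along a closed convex relation whose range has `0` in its core.  By
the open mapping argument, the form is bounded above near `0`. -/
theorem continuous_of_le_on_closed_convex [ContinuousSMul ℝ E] [LocallyConvexSpace ℝ E]
    [CompleteSpace E] [FirstCountableTopology E] [BarrelledSpace ℝ W] {C : Set (E × W)}
    (hC : Convex ℝ C) (hclosed : IsClosed C) {u₀ : E} (hu₀ : (u₀, (0 : W)) ∈ C)
    (hcore : ∀ w : W, ∃ δ > (0 : ℝ), ∃ u, (u, δ • w) ∈ C)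
    {θ : E →L[ℝ] ℝ} {c : ℝ} {ℓ : W →ₗ[ℝ] ℝ} (hle : ∀ u w, (u, w) ∈ C → ℓ w ≤ θ u + c) :
    Continuous ℓ := by
  obtain ⟨V, hV, hadd⟩ := IsTopologicalAddGroup.exists_antitone_basis_nhds_zero E
  have hθ1 : {d : E | θ d ≤ 1} ∈ 𝓝 (0 : E) :=
    (θ.continuous.tendsto' 0 0 (map_zero θ)).eventually_le_const one_pos
  have hex : ∀ n, ∃ U ∈ 𝓝 (0 : E), Convex ℝ U ∧ U ⊆ V n ∩ {d | θ d ≤ 1} := fun n => by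
    obtain ⟨U, ⟨h1, h2⟩, h3⟩ := (LocallyConvexSpace.convex_basis_zero ℝ E).mem_iff.1
      (inter_mem (hV.mem n) hθ1)
    exact ⟨U, h1, h2, h3⟩
  choose U hU0 hUconv hUV using hex
  have hB : ∀ n, closure {w | ∃ d ∈ U n, (u₀ + d, w) ∈ C} ∈ 𝓝 (0 : W) := by
    intro n
    have hUz : (0 : E) ∈ U n := mem_of_mem_nhds (hU0 n)
    refine mem_nhds_zero_of_barrel ?_ isClosed_closure (subset_closure ⟨0, hUz, by simpa using hu₀⟩)
      fun w => ?_
    · refine Convex.closure ?_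
      rintro w₁ ⟨d₁, hd₁, h₁⟩ w₂ ⟨d₂, hd₂, h₂⟩ s t hs ht hst
      refine ⟨s • d₁ + t • d₂, hUconv n hd₁ hd₂ hs ht hst, ?_⟩
      convert hC h₁ h₂ hs ht hst using 1
      ext
      · simp only [Prod.fst_add, Prod.smul_fst]
        obtain rfl : t = 1 - s := by linarith
        module
      · simp
    · obtain ⟨δ, hδ, u, hu⟩ := hcore w
      have htend : Tendsto (fun t : ℝ => t • (u - u₀)) (𝓝[>] 0) (𝓝 0) :=
        ((continuous_id.smul continuous_const).tendsto' (0 : ℝ) (0 : E)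
          (by simp)).mono_left nhdsWithin_le_nhds
      have hlt1 : ∀ᶠ t : ℝ in 𝓝[>] 0, t < 1 :=
        nhdsWithin_le_nhds (eventually_lt_nhds one_pos)
      obtain ⟨t, ht, ht1, ht0⟩ := ((htend.eventually (hU0 n)).and
        (hlt1.and self_mem_nhdsWithin)).exists
      refine ⟨t * δ, mul_pos ht0 hδ, subset_closure ⟨_, ht, ?_⟩⟩
      convert hC hu₀ hu (sub_nonneg.2 ht1.le) (le_of_lt ht0) (sub_add_cancel 1 t) using 1
      ext
      · simp only [Prod.fst_add, Prod.smul_fst]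
        module
      · simp [smul_smul]
  refine continuous_of_eventually_le ℓ (M := θ u₀ + 1 + c) ?_
  have h2 : Tendsto (fun w : W => (2 : ℝ) • w) (𝓝 0) (𝓝 0) :=
    (continuous_const_smul _).tendsto' _ _ (smul_zero _)
  filter_upwards [h2 (hB 0)] with z hz
  obtain ⟨a, ha, haC⟩ := exists_mem_of_two_smul_mem_closure hC hclosed hu₀ hV hadd
    (fun n => (hUV n).trans inter_subset_left) hU0 hUconv hB
    (fun n d hd => (hUV n hd).2) hz
  have := hle _ _ haC
  rw [map_add] at this
  linarith

end OpenMapping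

/-! ### The interior of the ordering cone and scalarization -/

section Cone

variable {Y : Type*} [AddCommGroup Y] [Module ℝ Y] [TopologicalSpace Y]
  {K : ConvexCone ℝ Y}

section SMul

variable [ContinuousSMul ℝ Y]

theorem smul_mem_interior {t : ℝ} (ht : 0 < t) {a : Y} (ha : a ∈ interior (K : Set Y)) :
    t • a ∈ interior (K : Set Y) := by
  have h : t • interior (K : Set Y) ⊆ interior (K : Set Y) := by
    refine interior_maximal ?_ (isOpen_interior.smul₀ ht.ne')
    rintro _ ⟨p, hp, rfl⟩
    exact K.smul_mem ht (interior_subset hp)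
  exact h (smul_mem_smul_set ha)

theorem zero_mem_of_isClosed (hK : IsClosed (K : Set Y)) (hne : (K : Set Y).Nonempty) :
    (0 : Y) ∈ K := by
  obtain ⟨k, hk⟩ := hne
  have hc : Tendsto (fun t : ℝ => t • k) (𝓝[>] 0) (𝓝 0) :=
    ((continuous_id.smul continuous_const).tendsto' (0 : ℝ) (0 : Y)
      (by simp)).mono_left nhdsWithin_le_nhds
  exact hK.mem_of_tendsto hc (eventually_mem_nhdsWithin.mono fun t ht => K.smul_mem ht hk)

end SMul

variable [IsTopologicalAddGroup Y]

theorem interior_add_mem {a b : Y} (ha : a ∈ interior (K : Set Y)) (hb : b ∈ K) :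
    a + b ∈ interior (K : Set Y) := by
  have h : interior (K : Set Y) + (K : Set Y) ⊆ interior (K : Set Y) := by
    refine interior_maximal ?_ isOpen_interior.add_right
    rintro _ ⟨p, hp, q, hq, rfl⟩
    exact K.add_mem (interior_subset hp) hq
  exact h (add_mem_add ha hb)

variable [ContinuousSMul ℝ Y]

/-- Interior points of `K` stay in the interior under small shifts along a line. -/
theorem exists_pos_add_smul_mem_interior {a : Y} (ha : a ∈ interior (K : Set Y)) (b : Y) :
    ∃ ε > (0 : ℝ), ∀ t : ℝ, |t| ≤ ε → a + t • b ∈ interior (K : Set Y) := by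
  have hc : Tendsto (fun t : ℝ => a + t • b) (𝓝 0) (𝓝 a) := by
    have : Continuous fun t : ℝ => a + t • b := by fun_prop
    exact this.tendsto' _ _ (by simp)
  obtain ⟨ε, hε, h⟩ := Metric.eventually_nhds_iff.1
    (hc.eventually_mem (isOpen_interior.mem_nhds ha))
  refine ⟨ε / 2, by positivity, fun t ht => h ?_⟩
  rw [Real.dist_0_eq_abs]
  linarith

theorem zero_notMem_interior (hK : (K : Set Y) ≠ univ) : (0 : Y) ∉ interior (K : Set Y) := by
  refine fun h => hK (eq_univ_of_forall fun y => ?_)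
  obtain ⟨ε, hε, h⟩ := exists_pos_add_smul_mem_interior h y
  have h1 := smul_mem_interior (inv_pos.2 hε) (h ε (abs_of_pos hε).le)
  rw [zero_add, inv_smul_smul₀ hε.ne'] at h1
  exact interior_subset h1

/-- A nonzero continuous functional that is nonnegative on `int K` is positive there. -/
theorem pos_on_interior {f : Y →L[ℝ] ℝ} (hf : f ≠ 0)
    (hnn : ∀ k ∈ interior (K : Set Y), 0 ≤ f k) {k : Y} (hk : k ∈ interior (K : Set Y)) :
    0 < f k := by
  refine (hnn k hk).lt_of_ne fun h0 => hf ?_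
  ext b
  obtain ⟨ε, hε, h⟩ := exists_pos_add_smul_mem_interior hk b
  have h1 := hnn _ (h ε (abs_of_pos hε).le)
  have h2 := hnn _ (h (-ε) (by rw [abs_neg, abs_of_pos hε]))
  rw [map_add, ← h0, map_smul, smul_eq_mul] at h1 h2
  have h3 : ε * f b = 0 := by linarith
  simpa [hε.ne'] using h3

/-- If no point of a convex set lies below `v` by an interior vector of `K`, then `v` minimizes over
`A ∪ {v}` a continuous functional that is positive on `int K`. -/
theorem exists_scalarization (hKint : (interior (K : Set Y)).Nonempty) {A : Set Y}
    (hA : Convex ℝ A) (hne : A.Nonempty) {v : Y} (hv : ∀ a ∈ A, v - a ∉ interior (K : Set Y)) :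
    ∃ f : Y →L[ℝ] ℝ, (∀ k ∈ interior (K : Set Y), 0 < f k) ∧ ∀ a ∈ A, f v ≤ f a := by
  obtain ⟨b, hb⟩ := hne
  obtain ⟨k₁, hk₁⟩ := hKint
  obtain ⟨f, u, hu, hAu⟩ := geometric_hahn_banach_open (K.convex.interior.neg.translate v)
    (isOpenMap_add_left v _ isOpen_interior.neg) hA (by
      rw [disjoint_left]
      rintro _ ⟨k, hk, rfl⟩ hkA
      exact hv _ hkA (by simpa using hk))
  have hlt : ∀ k ∈ interior (K : Set Y), f v - f k < u := fun k hk => by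
    have := hu _ ⟨-k, by simpa using hk, rfl⟩
    simpa [sub_eq_add_neg] using this
  have hnn : ∀ k ∈ interior (K : Set Y), 0 ≤ f k := by
    intro k hk
    by_contra! hneg
    -- a large multiple of `k` would break the separation, as positive multiples of `k` stay in `int K`
    have h1 := hlt _ (smul_mem_interior (t := (|u - f v| + 1) / -f k)
      (div_pos (by positivity) (by linarith)) hk)
    rw [map_smul, smul_eq_mul, div_mul_eq_mul_div, div_neg, mul_div_cancel_right₀ _ hneg.ne] at h1
    linarith [le_abs_self (u - f v)]
  have hvu : f v ≤ u := by
    refine le_of_forall_pos_lt_add fun ε hε => ?_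
    have hk := hlt _ (smul_mem_interior (t := ε / (f k₁ + 1))
      (div_pos hε (by linarith [hnn _ hk₁])) hk₁)
    rw [map_smul, smul_eq_mul] at hk
    have : ε / (f k₁ + 1) * f k₁ ≤ ε := by
      rw [div_mul_eq_mul_div, div_le_iff₀ (by linarith [hnn _ hk₁])]
      nlinarith [hnn _ hk₁]
    linarith
  have hf0 : f ≠ 0 := by
    rintro rfl
    have h1 := hlt _ hk₁
    have h2 := hAu _ hb
    simp at h1 h2
    linarith
  exact ⟨f, fun k hk => pos_on_interior hf0 hnn hk, fun a ha => hvu.trans (hAu a ha)⟩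

end Cone

/-! ### Multipliers for a convex set of perturbed values -/

section Multiplier

variable {X Y Z : Type*}
  [AddCommGroup X] [Module ℝ X] [TopologicalSpace X]
  [AddCommGroup Y] [Module ℝ Y] [TopologicalSpace Y] [IsTopologicalAddGroup Y]
  [ContinuousSMul ℝ Y]
  [AddCommGroup Z] [Module ℝ Z] [TopologicalSpace Z] [IsTopologicalAddGroup Z]
  [ContinuousSMul ℝ Z] [LocallyConvexSpace ℝ Z]

/-- The scalarization of `G` is subdifferentiable at `0`.  The continuity of a subgradient on `W` is
the only topological regularity needed, and enters as `hcont`; the vector multiplier is the rank-one map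
`z ↦ g z • k`, whose direction `k ∈ int K` makes the sign of `g` visible to the cone `K`. -/
theorem exists_multiplier {K : ConvexCone ℝ Y} (hKint : (interior (K : Set Y)).Nonempty)
    {G : Set ((X × Z) × Y)} (hG : Convex ℝ G) (W : Submodule ℝ Z) (hGW : ∀ p ∈ G, p.1.2 ∈ W)
    (hcore : ∀ w ∈ W, ∃ δ > (0 : ℝ), ∃ x y, ((x, δ • w), y) ∈ G)
    (hcont : ∀ (θ : X × Y →L[ℝ] ℝ) (c : ℝ) (ℓ : W →ₗ[ℝ] ℝ),
      (∀ x (w : W) y, ((x, (w : Z)), y) ∈ G → ℓ w ≤ θ (x, y) + c) → Continuous ℓ)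
    (L : X →L[ℝ] Y) {v : Y}
    (hv : ∀ x y, ((x, (0 : Z)), y) ∈ G → v - (y - L x) ∉ interior (K : Set Y)) :
    ∃ k ∈ interior (K : Set Y), ∃ g : Z →L[ℝ] ℝ,
      (∀ x z y, ((x, z), y) ∈ G → v - (y - L x - g z • k) ∉ interior (K : Set Y)) ∧
      ∀ s x z y, (∀ t > (0 : ℝ), ((x, z - t • s), y) ∈ G) → 0 ≤ g s := by
  obtain ⟨f, hfpos, hfv⟩ := exists_scalarization (K := K) hKint (v := v)
    (A := {a | ∃ x y, ((x, (0 : Z)), y) ∈ G ∧ y - L x = a}) (by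
      rintro _ ⟨x₁, y₁, h₁, rfl⟩ _ ⟨x₂, y₂, h₂, rfl⟩ s t hs ht hst
      refine ⟨s • x₁ + t • x₂, s • y₁ + t • y₂, by simpa using hG h₁ h₂ hs ht hst, ?_⟩
      simp only [map_add, map_smul]
      module) (by
      obtain ⟨δ, -, x, y, h⟩ := hcore 0 W.zero_mem
      exact ⟨_, x, y, by simpa using h, rfl⟩) (by
      rintro _ ⟨x, y, h, rfl⟩
      exact hv x y h)
  obtain ⟨k₁, hk₁⟩ := hKint
  have hf₁ := hfpos k₁ hk₁
  -- the epigraph of the scalarized perturbation function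
  obtain ⟨ℓ, hℓ⟩ := exists_linearMap_le_of_core
    (C := {p : W × ℝ | ∃ x y, ((x, (p.1 : Z)), y) ∈ G ∧ f y - f (L x) - f v = p.2}) (by
      rintro ⟨w₁, r₁⟩ ⟨x₁, y₁, h₁, e₁⟩ ⟨w₂, r₂⟩ ⟨x₂, y₂, h₂, e₂⟩ s t hs ht hst
      refine ⟨s • x₁ + t • x₂, s • y₁ + t • y₂, by simpa using hG h₁ h₂ hs ht hst, ?_⟩
      simp only [map_add, map_smul, smul_eq_mul, Prod.snd_add, Prod.smul_snd] at *
      rw [← e₁, ← e₂]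
      obtain rfl : t = 1 - s := by linarith
      ring) (by
      rintro _ ⟨x, y, h, rfl⟩
      have := hfv _ ⟨x, y, h, rfl⟩
      rw [map_sub] at this
      change 0 ≤ f y - f (L x) - f v
      linarith) (by
      intro w
      obtain ⟨δ, hδ, x, y, h⟩ := hcore w w.2
      exact ⟨δ, hδ, _, x, y, h, rfl⟩)
  have hle : ∀ x (w : W) y, ((x, (w : Z)), y) ∈ G → ℓ w ≤ f y - f (L x) - f v :=
    fun x w y h => hℓ w _ ⟨x, y, h, rfl⟩
  have hℓc : Continuous ℓ := by
    refine hcont (f.comp (ContinuousLinearMap.snd ℝ X Y) -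
      (f.comp L).comp (ContinuousLinearMap.fst ℝ X Y)) (-f v) ℓ fun x w y h => ?_
    simpa [sub_eq_add_neg] using hle x w y h
  obtain ⟨g, hg⟩ := StrongDual.exists_extension W (⟨ℓ, hℓc⟩ : W →L[ℝ] ℝ)
  have hgle : ∀ x z y, ((x, z), y) ∈ G → g z ≤ f y - f (L x) - f v := fun x z y h => by
    rw [show g z = ℓ ⟨z, hGW _ h⟩ from hg ⟨z, hGW _ h⟩]
    exact hle x ⟨z, hGW _ h⟩ y h
  refine ⟨(f k₁)⁻¹ • k₁, smul_mem_interior (inv_pos.2 hf₁) hk₁, g, fun x z y h hmem => ?_,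
    fun s x z y h => ?_⟩
  · have h1 := hfpos _ hmem
    simp only [map_sub, map_smul, smul_eq_mul, inv_mul_cancel₀ hf₁.ne', mul_one] at h1
    linarith [hgle x z y h]
  · by_contra! hneg
    have h1 := hgle _ _ _ (h ((|f y - f (L x) - f v - g z| + 1) / -g s)
      (div_pos (by positivity) (by linarith)))
    rw [map_sub, map_smul, smul_eq_mul, div_mul_eq_mul_div, div_neg,
      mul_div_cancel_right₀ _ hneg.ne] at h1
    linarith [le_abs_self (f y - f (L x) - f v - g z)]

end Multiplier

/-! ### Weak suprema and infima -/

section WeakExtrema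

variable {Y : Type*}

theorem Ext.neg_neg [AddCommGroup Y] (a : Ext Y) : a.neg.neg = a := by
  cases a <;> simp [Ext.neg]

variable [AddCommGroup Y] [Module ℝ Y] [TopologicalSpace Y] {K : ConvexCone ℝ Y}

theorem ltK_fin {a b : Y} :
    ltK K (Ext.fin a) (Ext.fin b) ↔ b - a ∈ interior (K : Set Y) := by
  change -(a - b) ∈ interior (K : Set Y) ↔ _
  rw [neg_sub]

theorem ltK_neg_comm {a b : Ext Y} : ltK K a.neg b.neg ↔ ltK K b a := by
  cases a <;> cases b <;> simp [Ext.neg, ltK]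
  rw [neg_add_eq_sub]

theorem ltK_trans [IsTopologicalAddGroup Y] {a b c : Ext Y} (hab : ltK K a b) (hbc : ltK K b c) :
    ltK K a c := by
  cases a <;> cases b <;> cases c <;> try first | exact hab.elim | exact hbc.elim | trivial
  rw [ltK_fin] at *
  convert interior_add_mem hbc (interior_subset hab) using 1
  abel

theorem wInf_eq_negInf {M : Set (Ext Y)} (h : ∀ v : Y, ∃ u ∈ M, ltK K u (Ext.fin v)) :
    wInf K M = {Ext.negInf} := by
  obtain ⟨u₀, hu₀, h₀⟩ := h 0
  have htop : ltK K u₀ Ext.posInf := by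
    cases u₀ <;> trivial
  ext v
  constructor
  · rintro ⟨h1, -⟩
    cases v with
    | negInf => rfl
    | fin v => obtain ⟨u, hu, huv⟩ := h v; exact (h1 u hu huv).elim
    | posInf => exact (h1 u₀ hu₀ htop).elim
  · rintro rfl
    refine ⟨fun u _ hu => by cases u <;> exact hu, fun w hw => ?_⟩
    cases w with
    | negInf => exact hw.elim
    | fin w => exact h w
    | posInf => exact ⟨u₀, hu₀, htop⟩

theorem wSup_eq_posInf {M : Set (Ext Y)} (h : ∀ v : Y, ∃ u ∈ M, ltK K (Ext.fin v) u) :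
    wSup K M = {Ext.posInf} := by
  obtain ⟨u₀, hu₀, h₀⟩ := h 0
  have hbot : ltK K Ext.negInf u₀ := by
    cases u₀ <;> trivial
  ext v
  constructor
  · rintro ⟨h1, -⟩
    cases v with
    | negInf => exact (h1 u₀ hu₀ hbot).elim
    | fin v => obtain ⟨u, hu, huv⟩ := h v; exact (h1 u hu huv).elim
    | posInf => rfl
  · rintro rfl
    refine ⟨fun u _ hu => by cases u <;> exact hu, fun w hw => ?_⟩
    cases w with
    | negInf => exact ⟨u₀, hu₀, hbot⟩
    | fin w => exact h w
    | posInf => exact hw.elim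

theorem wSup_ne_posInf_iff {M : Set (Ext Y)} :
    wSup K M ≠ {Ext.posInf} ↔ ∃ v : Y, ∀ u ∈ M, ¬ ltK K (Ext.fin v) u := by
  constructor
  · intro h
    by_contra! h'
    exact h (wSup_eq_posInf h')
  · rintro ⟨v, hv⟩ h
    have hp : Ext.posInf ∈ wSup K M := h ▸ rfl
    obtain ⟨u, hu, huv⟩ := hp.2 (Ext.fin v) trivial
    exact hv u hu huv

variable [IsTopologicalAddGroup Y] [ContinuousSMul ℝ Y]

/-- Moving a weak lower bound up along `k ∈ int K` as far as it remains one ends in the weak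
infimum. -/
theorem exists_add_smul_mem_wInf {M : Set (Ext Y)} {u₁ : Y} (hu₁ : Ext.fin u₁ ∈ M) {v : Y}
    (hv : ∀ u ∈ M, ¬ ltK K u (Ext.fin v)) {k : Y} (hk : k ∈ interior (K : Set Y)) :
    ∃ t : ℝ, (∀ s : ℝ, (∀ u ∈ M, ¬ ltK K u (Ext.fin (v + s • k))) → s ≤ t) ∧
      Ext.fin (v + t • k) ∈ wInf K M := by
  set A : Set ℝ := {s | ∀ u ∈ M, ¬ ltK K u (Ext.fin (v + s • k))} with hA
  have hmono : ∀ {u : Ext Y} {s t : ℝ}, s ≤ t → ltK K u (Ext.fin (v + s • k)) →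
      ltK K u (Ext.fin (v + t • k)) := by
    intro u s t hst h
    rcases hst.eq_or_lt with rfl | hlt
    · exact h
    · refine ltK_trans h (ltK_fin.2 ?_)
      convert smul_mem_interior (sub_pos.2 hlt) hk using 1
      module
  have h0 : (0 : ℝ) ∈ A := by simpa [hA] using hv
  have hbdd : BddAbove A := by
    obtain ⟨ε, hε, h⟩ := exists_pos_add_smul_mem_interior hk (v - u₁)
    refine ⟨ε⁻¹, fun s hs => le_of_not_gt fun hlt => hs _ hu₁ (hmono hlt.le (ltK_fin.2 ?_))⟩
    convert smul_mem_interior (inv_pos.2 hε) (h ε (abs_of_pos hε).le) using 1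
    rw [smul_add, inv_smul_smul₀ hε.ne']
    abel
  have hsup : ∀ t, sSup A < t → ∃ u ∈ M, ltK K u (Ext.fin (v + t • k)) := by
    intro t ht
    by_contra! h
    exact (le_csSup hbdd h).not_gt ht
  refine ⟨sSup A, fun s hs => le_csSup hbdd hs, fun u hu hlt => ?_, fun w hw => ?_⟩
  · -- `ltK` is an open condition, so it would persist for some parameter in `A`.
    obtain ⟨ε, hε, h⟩ : ∃ ε > (0 : ℝ), ltK K u (Ext.fin (v + (sSup A - ε) • k)) := by
      cases u with
      | negInf => exact ⟨1, one_pos, trivial⟩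
      | posInf => exact hlt.elim
      | fin u =>
        obtain ⟨ε, hε, h⟩ := exists_pos_add_smul_mem_interior (ltK_fin.1 hlt) k
        refine ⟨ε, hε, ltK_fin.2 ?_⟩
        convert h (-ε) (by rw [abs_neg, abs_of_pos hε]) using 1
        module
    obtain ⟨s, hs, hlt'⟩ := exists_lt_of_lt_csSup ⟨0, h0⟩ (sub_lt_self (sSup A) hε)
    exact hs u hu (hmono hlt'.le h)
  · cases w with
    | negInf => exact hw.elim
    | posInf => exact ⟨_, hu₁, trivial⟩
    | fin w =>
      obtain ⟨ε, hε, h⟩ := exists_pos_add_smul_mem_interior (ltK_fin.1 hw) k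
      obtain ⟨u, hu, hlt⟩ := hsup (sSup A + ε) (lt_add_of_pos_right _ hε)
      refine ⟨u, hu, ltK_trans hlt (ltK_fin.2 ?_)⟩
      convert h (-ε) (by rw [abs_neg, abs_of_pos hε]) using 1
      module

end WeakExtrema

/-! ### From multipliers to stable strong duality -/

section Duality

variable {X Y Z : Type*}
  [AddCommGroup X] [Module ℝ X] [TopologicalSpace X]
  [AddCommGroup Y] [Module ℝ Y] [TopologicalSpace Y]
  [AddCommGroup Z] [Module ℝ Z] [TopologicalSpace Z]
  {K : ConvexCone ℝ Y} {Φ : X × Z → WithTop Y}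

/-- Every weak lower bound `v` of a tilted primal problem `x ↦ Φ (x, 0) - L x` is certified by an
operator `T ∈ P`, in the sense that `v` is a weak lower bound of
`(x, z) ↦ Φ (x, z) - L x - T z`. -/
def HasMultipliers (K : ConvexCone ℝ Y) (Φ : X × Z → WithTop Y) (P : Set (Z →L[ℝ] Y)) : Prop :=
  ∀ (L : X →L[ℝ] Y) (v : Y), (∀ x, ¬ ltK K (topSub (Φ (x, 0)) (L x)) (Ext.fin v)) →
    ∃ T ∈ P, ∀ x z, ¬ ltK K (Ext.fin (-v)) (subTop (L x + T z) (Φ (x, z)))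

theorem HasMultipliers.mono {P Q : Set (Z →L[ℝ] Y)} (h : HasMultipliers K Φ P) (hPQ : P ⊆ Q) :
    HasMultipliers K Φ Q := fun L v hv =>
  let ⟨T, hT, hTv⟩ := h L v hv
  ⟨T, hPQ hT, hTv⟩

variable [IsTopologicalAddGroup Y]

theorem mem_LΦ_iff {T : Z →L[ℝ] Y} :
    T ∈ LΦ K Φ ↔ ∃ (L : X →L[ℝ] Y) (v : Y), ∀ x z,
      ¬ ltK K (Ext.fin v) (subTop (L x + T z) (Φ (x, z))) := by
  change (∃ L, wSup K _ ≠ _) ↔ _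
  simp only [wSup_ne_posInf_iff, forall_mem_range, Prod.forall, ContinuousLinearMap.coprod_apply]

theorem not_ltK_of_mem_neg_conjΦ {L : X →L[ℝ] Y} {T : Z →L[ℝ] Y} {d : Ext Y}
    (hd : d ∈ Ext.neg '' conjΦ K Φ L T) (x : X) :
    ¬ ltK K (topSub (Φ (x, 0)) (L x)) d := by
  obtain ⟨c, hc, rfl⟩ := hd
  intro h
  refine hc.1 _ ⟨(x, 0), rfl⟩ ?_
  rw [← Ext.neg_neg (topSub _ _), ltK_neg_comm] at h
  simpa [subTop] using h

/-- Multipliers give stable strong duality.  When the primal problem has a finite weak lower bound,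
its weak infimum is a set of finite vectors, each attained in the dual by its multiplier, and weak
duality forces the two sides to agree.  Otherwise both sides are `{-∞}`, which for the dual side
requires a feasible operator in `P`. -/
theorem wInfP_eq_wMaxD [ContinuousSMul ℝ Y] (hKint : (interior (K : Set Y)).Nonempty)
    (h0 : (0 : Z) ∈ projDom Φ) {P : Set (Z →L[ℝ] Y)} (hP : HasMultipliers K Φ P)
    (hne : (LΦ K Φ).Nonempty) (L : X →L[ℝ] Y) :
    wInfP K Φ L = wMaxD K Φ (LΦ K Φ ∩ P) L := by
  obtain ⟨⟨x₀, _⟩, hx₀, rfl : _ = (0 : Z)⟩ := h0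
  obtain ⟨y₀, hy₀⟩ := WithTop.ne_top_iff_exists.1 hx₀
  set M : Set (Ext Y) := range fun x : X => topSub (Φ (x, 0)) (L x)
  have hu₀ : Ext.fin (y₀ - L x₀) ∈ M := ⟨x₀, by simp only [← hy₀]; rfl⟩
  have hnegtop : ∀ (L : X →L[ℝ] Y) (T : Z →L[ℝ] Y) x, (subTop (L x + T 0) (Φ (x, 0))) =
      (topSub (Φ (x, 0)) (L x)).neg := fun L T x => by simp [subTop]
  by_cases hbd : ∃ v : Y, ∀ u ∈ M, ¬ ltK K u (Ext.fin v)
  · obtain ⟨v₀, hv₀⟩ := hbd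
    have hfin : ∀ v ∈ wInf K M, ∃ y, v = Ext.fin y := by
      rintro (_ | y | _) hv
      · obtain ⟨u, hu, hlt⟩ := hv.2 (Ext.fin v₀) trivial
        exact (hv₀ u hu hlt).elim
      · exact ⟨y, rfl⟩
      · exact (hv.1 _ hu₀ trivial).elim
    have hdual : ∀ v : Y, Ext.fin v ∈ wInf K M → Ext.fin v ∈
        ⋃ T ∈ LΦ K Φ ∩ P, Ext.neg '' conjΦ K Φ L T := by
      intro v hv
      obtain ⟨T, hTP, hT⟩ := hP L v fun x => hv.1 _ ⟨x, rfl⟩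
      refine mem_biUnion (x := T) ⟨mem_LΦ_iff.2 ⟨L, -v, hT⟩, hTP⟩
        ⟨Ext.fin (-v), ⟨?_, fun w hw => ?_⟩, by simp [Ext.neg]⟩
      · rintro _ ⟨⟨x, z⟩, rfl⟩
        exact hT x z
      · have hw' : ltK K (Ext.fin v) w.neg := by
          rw [← ltK_neg_comm, Ext.neg_neg]
          exact hw
        obtain ⟨_, ⟨x, rfl⟩, hlt⟩ := hv.2 _ hw'
        refine ⟨_, ⟨(x, 0), rfl⟩, ?_⟩
        change ltK K w (subTop (L x + T 0) (Φ (x, 0)))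
        rw [hnegtop, ← Ext.neg_neg w, ltK_neg_comm]
        exact hlt
    have hweak : ∀ d ∈ ⋃ T ∈ LΦ K Φ ∩ P, Ext.neg '' conjΦ K Φ L T, ∀ u ∈ M, ¬ ltK K u d := by
      intro d hd u hu
      obtain ⟨T, -, hd⟩ := mem_iUnion₂.1 hd
      obtain ⟨x, rfl⟩ := hu
      exact not_ltK_of_mem_neg_conjΦ hd x
    ext v
    constructor
    · intro hv
      obtain ⟨y, rfl⟩ := hfin v hv
      refine ⟨hdual y hv, fun d hd hlt => ?_, fun w hw => ⟨_, hdual y hv, hw⟩⟩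
      obtain ⟨u, hu, hlt'⟩ := hv.2 d hlt
      exact hweak d hd u hu hlt'
    · rintro ⟨hv, hmax⟩
      refine ⟨hweak v hv, fun w hw => ?_⟩
      cases w with
      | negInf => cases v <;> exact hw.elim
      | posInf => exact ⟨_, hu₀, trivial⟩
      | fin w =>
        by_contra! hno
        cases v with
        | posInf => exact hw.elim
        | negInf =>
          obtain ⟨k, hk⟩ := hKint
          obtain ⟨t, -, ht⟩ := exists_add_smul_mem_wInf hu₀ hv₀ hk
          exact hmax.1 _ (hdual _ ht) trivial
        | fin v =>
          -- raising `v` towards `w` as far as possible reaches a dual value beyond `v`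
          have hk := ltK_fin.1 hw
          obtain ⟨t, hle, ht⟩ := exists_add_smul_mem_wInf hu₀ (hweak _ hv) hk
          have ht1 : 1 ≤ t := hle 1 (by rwa [one_smul, add_sub_cancel])
          refine hmax.1 _ (hdual _ ht) (ltK_fin.2 ?_)
          simpa using smul_mem_interior (one_pos.trans_le ht1) hk
  · push Not at hbd
    have hconj : ∀ T : Z →L[ℝ] Y, conjΦ K Φ L T = {Ext.posInf} := by
      intro T
      refine wSup_eq_posInf fun v => ?_
      obtain ⟨_, ⟨x, rfl⟩, hlt⟩ := hbd (-v)
      refine ⟨_, ⟨(x, 0), rfl⟩, ?_⟩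
      change ltK K _ (subTop (L x + T 0) (Φ (x, 0)))
      rw [hnegtop, ← Ext.neg_neg (Ext.fin v), ltK_neg_comm]
      exact hlt
    obtain ⟨T', hT'⟩ := hne
    obtain ⟨L', v', hv'⟩ := mem_LΦ_iff.1 hT'
    obtain ⟨T, hTP, hT⟩ := hP L' (-v') fun x => by
      have := hv' x 0
      rwa [hnegtop, ← Ext.neg_neg (Ext.fin v'), ltK_neg_comm] at this
    have hTmem : T ∈ LΦ K Φ ∩ P := ⟨mem_LΦ_iff.2 ⟨L', _, hT⟩, hTP⟩
    have hU : ⋃ T ∈ LΦ K Φ ∩ P, Ext.neg '' conjΦ K Φ L T = {Ext.negInf} := by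
      simp only [hconj, image_singleton]
      exact biUnion_const ⟨T, hTmem⟩ _
    rw [wInfP, wInf_eq_negInf hbd, wMaxD, hU]
    symm
    refine inter_eq_left.2 (singleton_subset_iff.2 ⟨?_, fun w hw => ?_⟩)
    · rintro _ rfl h
      exact h
    · cases w <;> exact hw.elim

end Duality

/-! ### Epigraphs and their domains -/

section Epigraph

variable {X Y Z : Type*} [AddCommGroup Y] [Module ℝ Y] {K : ConvexCone ℝ Y}
  {Φ : X × Z → WithTop Y}

theorem leK_coe {a b : Y} : leK K (a : WithTop Y) (b : WithTop Y) ↔ b - a ∈ K := by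
  change -(a - b) ∈ K ↔ _
  rw [neg_sub]

theorem leK_refl (h0 : (0 : Y) ∈ K) (a : Y) : leK K (a : WithTop Y) (a : WithTop Y) :=
  leK_coe.2 (by rwa [sub_self])

theorem leK_trans_coe {a b : WithTop Y} {c : Y} (hab : leK K a b)
    (hbc : leK K b (c : WithTop Y)) : leK K a (c : WithTop Y) := by
  induction b with
  | top => exact hbc.elim
  | coe b =>
    induction a with
    | top => exact hab.elim
    | coe a =>
      rw [leK_coe] at *
      simpa using K.add_mem hbc hab

theorem mem_domF_of_mem_epiK {p : (X × Z) × Y} (hp : p ∈ epiK K Φ) : p.1 ∈ domF Φ := by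
  intro h
  have : leK K (Φ p.1) (p.2 : WithTop Y) := hp
  rw [h] at this
  exact this

theorem mem_projDom_iff (h0 : (0 : Y) ∈ K) {z : Z} :
    z ∈ projDom Φ ↔ ∃ x y, ((x, z), y) ∈ epiK K Φ := by
  constructor
  · rintro ⟨⟨x, z⟩, hx, rfl⟩
    obtain ⟨y, hy⟩ := WithTop.ne_top_iff_exists.1 hx
    refine ⟨x, y, ?_⟩
    change leK K (Φ (x, z)) y
    rw [← hy]
    exact leK_refl h0 y
  · rintro ⟨x, y, h⟩
    exact ⟨(x, z), mem_domF_of_mem_epiK h, rfl⟩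

theorem not_ltK_subTop [TopologicalSpace Y] (h0 : (0 : Y) ∈ K) {a v : Y} {x : X} {z : Z}
    (h : ∀ y, ((x, z), y) ∈ epiK K Φ → v - (y - a) ∉ interior (K : Set Y)) :
    ¬ ltK K (Ext.fin (-v)) (subTop a (Φ (x, z))) := by
  rcases hΦ : Φ (x, z) with _ | y
  · exact id
  · have hy : ((x, z), y) ∈ epiK K Φ := by
      change leK K (Φ (x, z)) y
      rw [hΦ]
      exact leK_refl h0 y
    refine fun hlt => h y hy ?_
    have := ltK_fin.1 (show ltK K (Ext.fin (-v)) (Ext.fin (-(y - a))) from hlt)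
    rwa [sub_neg_eq_add, neg_add_eq_sub] at this

variable [AddCommGroup Z] [Module ℝ Z]

theorem snd_mem_Z₀_of_mem_epiK {p : (X × Z) × Y} (hp : p ∈ epiK K Φ) : p.1.2 ∈ Z₀ Φ :=
  Submodule.subset_span ⟨p.1, mem_domF_of_mem_epiK hp, rfl⟩

end Epigraph

section Domain

variable {X Y Z : Type*} [AddCommGroup Z] [Module ℝ Z] {Φ : X × Z → WithTop Y}

theorem coe_Z₀_eq_affineSpan (h0 : (0 : Z) ∈ projDom Φ) :
    (Z₀ Φ : Set Z) = affineSpan ℝ (projDom Φ) := by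
  rw [Z₀, ← affineSpan_insert_zero, insert_eq_of_mem h0]

theorem exists_smul_mem_projDom_of_icr (h0 : (0 : Z) ∈ projDom Φ) (h : (0 : Z) ∈ icr (projDom Φ))
    {w : Z} (hw : w ∈ Z₀ Φ) : ∃ δ > (0 : ℝ), δ • w ∈ projDom Φ := by
  obtain ⟨δ, hδ, h⟩ := h w (by rwa [← SetLike.mem_coe, ← coe_Z₀_eq_affineSpan h0])
  exact ⟨δ, hδ, by simpa using h δ ⟨hδ.le, le_rfl⟩⟩

theorem exists_smul_mem_projDom_of_intrinsicInterior [TopologicalSpace Z] [ContinuousSMul ℝ Z]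
    (h0 : (0 : Z) ∈ projDom Φ) (h : (0 : Z) ∈ intrinsicInterior ℝ (projDom Φ))
    {w : Z} (hw : w ∈ Z₀ Φ) : ∃ δ > (0 : ℝ), δ • w ∈ projDom Φ := by
  obtain ⟨a, ha, ha0⟩ := h
  have hmem : ∀ t : ℝ, t • w ∈ affineSpan ℝ (projDom Φ) := fun t => by
    rw [← SetLike.mem_coe, ← coe_Z₀_eq_affineSpan h0]
    exact (Z₀ Φ).smul_mem t hw
  have hc : Tendsto (fun t : ℝ => (⟨t • w, hmem t⟩ : affineSpan ℝ (projDom Φ))) (𝓝[>] 0) (𝓝 a) := by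
    have : Continuous fun t : ℝ => (⟨t • w, hmem t⟩ : affineSpan ℝ (projDom Φ)) := by fun_prop
    refine (this.tendsto' 0 a ?_).mono_left nhdsWithin_le_nhds
    ext
    simp [ha0]
  obtain ⟨t, ht, ht0⟩ := ((hc.eventually_mem (mem_interior_iff_mem_nhds.1 ha)).and
    self_mem_nhdsWithin).exists
  exact ⟨t, ht0, ht⟩

end Domain

/-! ### Operators compatible with recession directions -/

section RecessionOperators

variable {X Y Z : Type*} [AddCommGroup Y] [Module ℝ Y] [TopologicalSpace Y]
  [AddCommGroup Z] [Module ℝ Z] [TopologicalSpace Z] {K : ConvexCone ℝ Y} {Φ : X × Z → WithTop Y}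

/-- The operators that map into `K` every direction `s` along which `G` can be followed
indefinitely: `(x, z - t • s, y) ∈ G` for some fixed `x`, `z`, `y` and all `t > 0`. -/
def recessionOperators (K : ConvexCone ℝ Y) (G : Set ((X × Z) × Y)) : Set (Z →L[ℝ] Y) :=
  {T | ∀ s x z y, (∀ t > (0 : ℝ), ((x, z - t • s), y) ∈ G) → T s ∈ K}

/-- Under `C0` every `s ∈ S` is a direction along which the epigraph can be followed
indefinitely. -/
theorem map_mem_of_C0 {S : ConvexCone ℝ Z} (hC0 : C0 K S Φ) {T : Z →L[ℝ] Y}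
    (hT : T ∈ recessionOperators K (epiK K Φ)) : ∀ s ∈ S, T s ∈ K := by
  obtain ⟨x, hx, h⟩ := hC0
  obtain ⟨y, hy⟩ := WithTop.ne_top_iff_exists.1 hx
  refine fun s hs => hT s x 0 y fun t ht => ?_
  have := h (0 - t • s) (by simpa using S.smul_mem ht hs)
  rwa [← hy] at this

end RecessionOperators

/-! ### Multipliers under the regularity conditions -/

section Multipliers

variable {X Y Z : Type*}
  [AddCommGroup X] [Module ℝ X] [TopologicalSpace X]
  [AddCommGroup Y] [Module ℝ Y] [TopologicalSpace Y] [IsTopologicalAddGroup Y]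
  {K : ConvexCone ℝ Y} {Φ : X × Z → WithTop Y}

theorem notMem_interior_of_mem_epiK {L : X →L[ℝ] Y} {v : Y} {x : X} {z : Z}
    (h : ¬ ltK K (topSub (Φ (x, z)) (L x)) (Ext.fin v)) {y : Y} (hy : ((x, z), y) ∈ epiK K Φ) :
    v - (y - L x) ∉ interior (K : Set Y) := by
  obtain ⟨b, hb⟩ := WithTop.ne_top_iff_exists.1 (mem_domF_of_mem_epiK hy)
  have hby : leK K (Φ (x, z)) y := hy
  dsimp only at hb
  rw [← hb] at h hby
  refine fun hmem => h (ltK_fin.2 ?_)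
  convert interior_add_mem hmem (leK_coe.1 hby) using 1
  abel

variable [AddCommGroup Z] [Module ℝ Z] [TopologicalSpace Z]

/-- When the unperturbed parameter is already optimal for every `x`, the zero operator is a
multiplier. -/
theorem hasMultipliers_zero (h0 : (0 : Y) ∈ K)
    (h : ∀ x z, (x, z) ∈ domF Φ → leK K (Φ (x, 0)) (Φ (x, z))) :
    HasMultipliers K Φ {0} := by
  refine fun L v hv => ⟨0, rfl, fun x z => not_ltK_subTop h0 fun y hy => ?_⟩
  simpa using notMem_interior_of_mem_epiK (hv x)
    (leK_trans_coe (h x z (mem_domF_of_mem_epiK hy)) hy : ((x, 0), y) ∈ epiK K Φ)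

variable [ContinuousSMul ℝ Y] [IsTopologicalAddGroup Z] [ContinuousSMul ℝ Z]
  [LocallyConvexSpace ℝ Z]

/-- Multipliers for `Φ` obtained from a convex set `G` containing the epigraph of `Φ` and having the
same section over the parameter `0`.  Directions `s` along which `G` can be followed indefinitely
downwards over fixed `x` and `y` are mapped into `K`. -/
theorem hasMultipliers_of_epiK_subset (hKint : (interior (K : Set Y)).Nonempty) (h0 : (0 : Y) ∈ K)
    {G : Set ((X × Z) × Y)} (hG : Convex ℝ G) (hΦG : epiK K Φ ⊆ G)
    (hG0 : ∀ x y, ((x, (0 : Z)), y) ∈ G → ((x, (0 : Z)), y) ∈ epiK K Φ)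
    (W : Submodule ℝ Z) (hGW : ∀ p ∈ G, p.1.2 ∈ W)
    (hcore : ∀ w ∈ W, ∃ δ > (0 : ℝ), ∃ x y, ((x, δ • w), y) ∈ G)
    (hcont : ∀ (θ : X × Y →L[ℝ] ℝ) (c : ℝ) (ℓ : W →ₗ[ℝ] ℝ),
      (∀ x (w : W) y, ((x, (w : Z)), y) ∈ G → ℓ w ≤ θ (x, y) + c) → Continuous ℓ) :
    HasMultipliers K Φ (recessionOperators K G) := by
  intro L v hv
  obtain ⟨k, hk, g, hg, hpos⟩ := exists_multiplier hKint hG W hGW hcore hcont L (v := v)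
    fun x y h => notMem_interior_of_mem_epiK (hv x) (hG0 x y h)
  refine ⟨g.smulRight k, fun s x z y h => ?_, fun x z => not_ltK_subTop h0 fun y hy => ?_⟩
  · rw [ContinuousLinearMap.smulRight_apply]
    rcases (hpos s x z y h).eq_or_lt with h1 | h1
    · rwa [← h1, zero_smul]
    · exact K.smul_mem h1 (interior_subset hk)
  · rw [ContinuousLinearMap.smulRight_apply, ← sub_sub]
    exact hg x z y (hΦG hy)

/-- The regularity hypotheses of `hasMultipliers_of_epiK_subset` hold when `G` contains a constant
section over a neighbourhood of `0` in `W`. -/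
theorem hasMultipliers_of_eventually (hKint : (interior (K : Set Y)).Nonempty) (h0 : (0 : Y) ∈ K)
    {G : Set ((X × Z) × Y)} (hG : Convex ℝ G) (hΦG : epiK K Φ ⊆ G)
    (hG0 : ∀ x y, ((x, (0 : Z)), y) ∈ G → ((x, (0 : Z)), y) ∈ epiK K Φ)
    (W : Submodule ℝ Z) (hGW : ∀ p ∈ G, p.1.2 ∈ W) {x₀ : X} {y₀ : Y}
    (hev : ∀ᶠ w : W in 𝓝 0, ((x₀, (w : Z)), y₀) ∈ G) :
    HasMultipliers K Φ (recessionOperators K G) := by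
  refine hasMultipliers_of_epiK_subset hKint h0 hG hΦG hG0 W hGW (fun w hw => ?_)
    fun θ c ℓ hℓ => continuous_of_eventually_le ℓ (M := θ (x₀, y₀) + c)
      (hev.mono fun w h => hℓ x₀ w y₀ h)
  have hc : Tendsto (fun t : ℝ => t • (⟨w, hw⟩ : W)) (𝓝[>] 0) (𝓝 0) :=
    ((continuous_id.smul continuous_const).tendsto' (0 : ℝ) (0 : W)
      (by simp)).mono_left nhdsWithin_le_nhds
  obtain ⟨t, ht, ht0⟩ := ((hc.eventually hev).and self_mem_nhdsWithin).exists
  exact ⟨t, ht0, x₀, y₀, ht⟩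

/-- The perturbations are first enlarged downwards by `S`.  Since `C7` makes `0` the best parameter
among those above it, this does not change the values at `0`, while it makes a finite value at a
point of `int S` bound the perturbation function on a neighbourhood of `0`. -/
theorem hasMultipliers_of_C7 (hKint : (interior (K : Set Y)).Nonempty) (h0 : (0 : Y) ∈ K)
    {S : ConvexCone ℝ Z} (hΦ : KConvex K Φ) (h : C7 K S Φ) :
    HasMultipliers K Φ {T | ∀ s ∈ S, T s ∈ K} := by
  obtain ⟨⟨z₀, hz₀, s₀, hs₀, hzs⟩, hS⟩ := h
  obtain rfl : z₀ = s₀ := sub_eq_zero.1 hzs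
  obtain ⟨x₀, y₀, hxy⟩ := (mem_projDom_iff h0).1 hz₀
  -- over `(x, z')`, the values above some `Φ (x, z)` with `z ≥ z'` in the order induced by `S`
  set G : Set ((X × Z) × Y) :=
    {p | ∃ z, ((p.1.1, z), p.2) ∈ epiK K Φ ∧ z - p.1.2 ∈ adjoinZero S}
  have hG : Convex ℝ G := by
    rintro ⟨⟨x₁, z₁⟩, y₁⟩ ⟨w₁, h₁, e₁⟩ ⟨⟨x₂, z₂⟩, y₂⟩ ⟨w₂, h₂, e₂⟩ s t hs ht hst
    refine ⟨s • w₁ + t • w₂, hΦ h₁ h₂ hs ht hst, ?_⟩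
    have he := (adjoinZero S).convex e₁ e₂ hs ht hst
    rw [smul_sub, smul_sub, sub_add_sub_comm] at he
    exact he
  refine (hasMultipliers_of_eventually hKint h0 hG ?_ ?_ ⊤ (fun _ _ => trivial)
    (x₀ := x₀) (y₀ := y₀) ?_).mono ?_
  · exact fun p hp => ⟨p.1.2, hp, Or.inl (sub_self _)⟩
  · rintro x y ⟨z, hz, hzS⟩
    dsimp only at hzS hz
    rw [sub_zero] at hzS
    rcases hzS with rfl | hzS
    · exact hz
    · exact leK_trans_coe (hS x z (mem_domF_of_mem_epiK hz) (by simpa using hzS)) hz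
  · have hc : Tendsto (fun w : (⊤ : Submodule ℝ Z) => z₀ - (w : Z)) (𝓝 0) (𝓝 z₀) := by
      have : Continuous fun w : (⊤ : Submodule ℝ Z) => z₀ - (w : Z) := by fun_prop
      exact this.tendsto' _ _ (by simp)
    filter_upwards [hc.eventually_mem (mem_interior_iff_mem_nhds.1 hs₀)] with w hw
    exact ⟨z₀, hxy, Or.inr hw⟩
  · intro T hT s hs
    refine hT s x₀ z₀ y₀ fun t ht => ⟨z₀, hxy, Or.inr ?_⟩
    simpa using S.smul_mem ht hs

theorem C2.hasMultipliers (hKint : (interior (K : Set Y)).Nonempty) (h0 : (0 : Y) ∈ K)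
    (hΦ : KConvex K Φ) (h : C2 K Φ) :
    HasMultipliers K Φ (recessionOperators K (epiK K Φ)) := by
  obtain ⟨x, y, V, hV, h⟩ := h
  refine hasMultipliers_of_eventually hKint h0 hΦ Subset.rfl (fun _ _ => id) (Z₀ Φ)
    (fun p => snd_mem_Z₀_of_mem_epiK) (x₀ := x) (y₀ := y) ?_
  have hc : Tendsto (fun w : Z₀ Φ => (w : Z)) (𝓝 0) (𝓝 0) :=
    continuous_subtype_val.tendsto' _ _ rfl
  filter_upwards [hc hV] with w hw
  exact h w ⟨hw, w.2⟩

theorem C3.hasMultipliers (hKint : (interior (K : Set Y)).Nonempty) (h0 : (0 : Y) ∈ K)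
    (hΦ : KConvex K Φ) (h : C3 Φ) :
    HasMultipliers K Φ (recessionOperators K (epiK K Φ)) := by
  obtain ⟨x, y, hxy, h⟩ := h
  obtain ⟨k, hk⟩ := hKint
  refine hasMultipliers_of_eventually ⟨k, hk⟩ h0 hΦ Subset.rfl (fun _ _ => id) (Z₀ Φ)
    (fun p => snd_mem_Z₀_of_mem_epiK) (x₀ := x) (y₀ := y + k) ?_
  -- the vectors below `y + k` form a neighbourhood of `y`
  have hnhds : {a : Y | leK K (a : WithTop Y) ((y + k : Y) : WithTop Y)} ∈ 𝓝 y := by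
    have hc : Tendsto (fun a : Y => y + k - a) (𝓝 y) (𝓝 k) := by
      have : Continuous fun a : Y => y + k - a := by fun_prop
      exact this.tendsto' _ _ (by simp)
    filter_upwards [hc.eventually_mem (mem_interior_iff_mem_nhds.1 hk)] with a ha
    exact leK_coe.2 ha
  exact h (show {b | leK K b ((y + k : Y) : WithTop Y)} ∈ map _ (𝓝 y) from hnhds)

theorem C4.hasMultipliers [T2Space Z] (hKint : (interior (K : Set Y)).Nonempty) (h0 : (0 : Y) ∈ K)
    (hΦ : KConvex K Φ) (hdom : (0 : Z) ∈ projDom Φ) (h : C4 Φ) :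
    HasMultipliers K Φ (recessionOperators K (epiK K Φ)) := by
  obtain ⟨hfin, hri⟩ := h
  refine hasMultipliers_of_epiK_subset hKint h0 hΦ Subset.rfl (fun _ _ => id) (Z₀ Φ)
    (fun p => snd_mem_Z₀_of_mem_epiK) (fun w hw => ?_)
    fun θ c ℓ _ => ℓ.continuous_of_finiteDimensional
  obtain ⟨δ, hδ, h⟩ := exists_smul_mem_projDom_of_intrinsicInterior hdom hri hw
  exact ⟨δ, hδ, (mem_projDom_iff h0).1 h⟩

/-- A `K`-epi closed `K`-convex `Φ` has a continuous affine weak minorant: separate the epigraph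
from a point strictly below it. -/
theorem LΦ_nonempty_of_KEpiClosed [IsTopologicalAddGroup X] [ContinuousSMul ℝ X]
    [LocallyConvexSpace ℝ X] [LocallyConvexSpace ℝ Y] (hKint : (interior (K : Set Y)).Nonempty)
    (hKproper : (K : Set Y) ≠ univ) (h0 : (0 : Y) ∈ K) (hΦ : KConvex K Φ)
    (hclosed : KEpiClosed K Φ) (hdom : (0 : Z) ∈ projDom Φ) : (LΦ K Φ).Nonempty := by
  obtain ⟨⟨x₀, _⟩, hx₀, rfl : _ = (0 : Z)⟩ := hdom
  obtain ⟨y₀, hy₀⟩ := WithTop.ne_top_iff_exists.1 hx₀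
  obtain ⟨k₁, hk₁⟩ := hKint
  have hmem : ∀ k ∈ K, ((x₀, (0 : Z)), y₀ + k) ∈ epiK K Φ := fun k hk => by
    change leK K (Φ (x₀, 0)) _
    rw [← hy₀]
    exact leK_coe.2 (by rwa [add_sub_cancel_left])
  have hnot : ((x₀, (0 : Z)), y₀ - k₁) ∉ epiK K Φ := fun h => by
    have h' : leK K (Φ (x₀, 0)) ((y₀ - k₁ : Y) : WithTop Y) := h
    rw [← hy₀, leK_coe, sub_sub_cancel_left] at h'
    exact zero_notMem_interior hKproper (by simpa using interior_add_mem hk₁ h')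
  obtain ⟨F, u, hFlt, hFu⟩ := geometric_hahn_banach_point_closed hΦ hclosed hnot
  set φ : Y →L[ℝ] ℝ := F.comp (ContinuousLinearMap.inr ℝ (X × Z) Y) with hφ
  have hsplit : ∀ p y, F (p, y) = F (p, 0) + φ y := fun p y => by
    rw [hφ, ContinuousLinearMap.comp_apply, ContinuousLinearMap.inr_apply, ← map_add]
    simp
  have hnn : ∀ k ∈ interior (K : Set Y), 0 ≤ φ k := by
    intro k hk
    by_contra! hneg
    have h1 := hFu _ (hmem _ (K.smul_mem (c := (|F ((x₀, 0), y₀) - u| + 1) / -φ k)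
      (div_pos (by positivity) (by linarith)) (interior_subset hk)))
    rw [hsplit, map_add, ← add_assoc, ← hsplit, map_smul, smul_eq_mul, div_mul_eq_mul_div, div_neg,
      mul_div_cancel_right₀ _ hneg.ne] at h1
    linarith [le_abs_self (F ((x₀, 0), y₀) - u)]
  have hφ0 : φ ≠ 0 := fun h => by
    have h1 := hFu _ (hmem 0 h0)
    rw [hsplit, h] at h1 hFlt
    simp only [zero_apply] at h1 hFlt
    linarith
  have hpos : ∀ k ∈ interior (K : Set Y), 0 < φ k := fun k hk => pos_on_interior hφ0 hnn hk
  set k : Y := (φ k₁)⁻¹ • k₁ with hk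
  have hφk : φ k = 1 := by
    rw [hk, map_smul, smul_eq_mul, inv_mul_cancel₀ (hpos k₁ hk₁).ne']
  set ψ : X × Z →L[ℝ] ℝ := F.comp (ContinuousLinearMap.inl ℝ (X × Z) Y) with hψ
  refine ⟨-(ψ.comp (ContinuousLinearMap.inr ℝ X Z)).smulRight k, mem_LΦ_iff.2
    ⟨-(ψ.comp (ContinuousLinearMap.inl ℝ X Z)).smulRight k, -(u • k), fun x z =>
      not_ltK_subTop h0 fun y hy hint => ?_⟩⟩
  have h1 := hpos _ hint
  have h2 := hFu _ hy
  have h3 : F ((x, z), 0) = ψ (x, 0) + ψ (0, z) := by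
    rw [← map_add, hψ]
    simp
  rw [hsplit, h3] at h2
  simp only [neg_apply, ContinuousLinearMap.smulRight_apply,
    ContinuousLinearMap.comp_apply, ContinuousLinearMap.inl_apply, ContinuousLinearMap.inr_apply,
    map_sub, map_add, map_neg, map_smul, smul_eq_mul, hφk, mul_one] at h1
  linarith

end Multipliers

/-! ### Multipliers for closed mappings over a barrelled space -/

section Barrelled

variable {X Y Z : Type*}
  [AddCommGroup X] [Module ℝ X] [UniformSpace X] [IsUniformAddGroup X] [ContinuousSMul ℝ X]
  [LocallyConvexSpace ℝ X]
  [AddCommGroup Y] [Module ℝ Y] [UniformSpace Y] [IsUniformAddGroup Y] [ContinuousSMul ℝ Y]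
  [LocallyConvexSpace ℝ Y]
  [AddCommGroup Z] [Module ℝ Z] [TopologicalSpace Z] [IsTopologicalAddGroup Z]
  [ContinuousSMul ℝ Z] [LocallyConvexSpace ℝ Z]
  {K : ConvexCone ℝ Y} {Φ : X × Z → WithTop Y}

theorem C5.hasMultipliers (hKint : (interior (K : Set Y)).Nonempty) (h0 : (0 : Y) ∈ K)
    (hΦ : KConvex K Φ) (hdom : (0 : Z) ∈ projDom Φ) (h : C5 K Φ) :
    HasMultipliers K Φ (recessionOperators K (epiK K Φ)) := by
  obtain ⟨⟨hX, hX'⟩, ⟨hY, hY'⟩, hbar, hclosed, hicr⟩ := h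
  have hcore : ∀ w ∈ Z₀ Φ, ∃ δ > (0 : ℝ), ∃ x y, ((x, δ • w), y) ∈ epiK K Φ := fun w hw => by
    obtain ⟨δ, hδ, h⟩ := exists_smul_mem_projDom_of_icr hdom hicr hw
    exact ⟨δ, hδ, (mem_projDom_iff h0).1 h⟩
  refine hasMultipliers_of_epiK_subset hKint h0 hΦ Subset.rfl (fun _ _ => id) (Z₀ Φ)
    (fun p => snd_mem_Z₀_of_mem_epiK) hcore fun θ c ℓ hℓ => ?_
  obtain ⟨x₀, y₀, hxy⟩ := (mem_projDom_iff h0).1 hdom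
  refine continuous_of_le_on_closed_convex (θ := θ) (c := c) (u₀ := (x₀, y₀))
    (C := {p : (X × Y) × Z₀ Φ | ((p.1.1, (p.2 : Z)), p.1.2) ∈ epiK K Φ}) ?_ ?_ hxy ?_ ?_
  · intro p hp q hq s t hs ht hst
    exact hΦ hp hq hs ht hst
  · have hc : Continuous fun p : (X × Y) × Z₀ Φ => ((p.1.1, (p.2 : Z)), p.1.2) := by fun_prop
    exact hclosed.preimage hc
  · intro w
    obtain ⟨δ, hδ, x, y, h⟩ := hcore w w.2
    exact ⟨δ, hδ, (x, y), h⟩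
  · exact fun u w h => hℓ u.1 w u.2 h

end Barrelled
end VecDual

open VecDual

theorem mainTheorem7 {X Y Z : Type*}
    [AddCommGroup X] [Module ℝ X] [UniformSpace X] [IsUniformAddGroup X] [ContinuousSMul ℝ X]
    [LocallyConvexSpace ℝ X] [T2Space X]
    [AddCommGroup Y] [Module ℝ Y] [UniformSpace Y] [IsUniformAddGroup Y] [ContinuousSMul ℝ Y]
    [LocallyConvexSpace ℝ Y] [T2Space Y]
    [AddCommGroup Z] [Module ℝ Z] [TopologicalSpace Z] [IsTopologicalAddGroup Z]
    [ContinuousSMul ℝ Z] [LocallyConvexSpace ℝ Z] [T2Space Z]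
    (K : ConvexCone ℝ Y) (hKclosed : IsClosed (K : Set Y))
    (hKint : (interior (K : Set Y)).Nonempty) (hKproper : (K : Set Y) ≠ Set.univ)
    (S : ConvexCone ℝ Z) (hS : (S : Set Z).Nonempty)
    (Φ : X × Z → WithTop Y) (h0 : (0 : Z) ∈ VecDual.projDom Φ) (hΦ : VecDual.KConvex K Φ) :
    (VecDual.C7 K S Φ → (VecDual.LΦ K Φ).Nonempty →
      VecDual.StableStrongDuality K Φ ∧ VecDual.StableStrongDualityLoose K S Φ) ∧
    (VecDual.C5 K Φ ∨
        ((VecDual.LΦ K Φ).Nonempty ∧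
          (VecDual.C2 K Φ ∨ VecDual.C3 Φ ∨ VecDual.C4 Φ ∨ VecDual.C6 K Φ)) →
      VecDual.StableStrongDuality K Φ ∧
        (VecDual.C0 K S Φ → VecDual.StableStrongDualityLoose K S Φ)) := by
  have hK0 : (0 : Y) ∈ K := zero_mem_of_isClosed hKclosed (hKint.mono interior_subset)
  have strong : ∀ {P : Set (Z →L[ℝ] Y)}, HasMultipliers K Φ P → (LΦ K Φ).Nonempty →
      StableStrongDuality K Φ := fun hP hne L => by
    simpa using wInfP_eq_wMaxD hKint h0 (hP.mono (subset_univ _)) hne L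
  have loose : HasMultipliers K Φ {T | ∀ s ∈ S, T s ∈ K} → (LΦ K Φ).Nonempty →
      StableStrongDualityLoose K S Φ := fun hP hne L => wInfP_eq_wMaxD hKint h0 hP hne L
  refine ⟨fun h7 hne => ?_, fun h => ?_⟩
  · have hP := hasMultipliers_of_C7 hKint hK0 hΦ h7
    exact ⟨strong hP hne, loose hP hne⟩
  · have hP : (LΦ K Φ).Nonempty ∧ HasMultipliers K Φ (recessionOperators K (epiK K Φ)) := by
      rcases h with h5 | ⟨hne, h2 | h3 | h4 | h6⟩
      · exact ⟨LΦ_nonempty_of_KEpiClosed hKint hKproper hK0 hΦ h5.2.2.2.1 h0,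
          h5.hasMultipliers hKint hK0 hΦ h0⟩
      · exact ⟨hne, h2.hasMultipliers hKint hK0 hΦ⟩
      · exact ⟨hne, h3.hasMultipliers hKint hK0 hΦ⟩
      · exact ⟨hne, h4.hasMultipliers hKint hK0 hΦ h0⟩
      · refine ⟨hne, (hasMultipliers_zero hK0 h6.1).mono ?_⟩
        rintro _ rfl s x z y -
        exact hK0
    exact ⟨strong hP.2 hP.1, fun hC0 =>
      loose (hP.2.mono fun T hT => map_mem_of_C0 hC0 hT) hP.1⟩
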